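/- **Notation.** Let $T\in(0,\infty]$, $\alpha\in(0,\frac{\pi}{2})$, and let $S_\alpha=\{re^{i\theta} : r\in\mathbb{R},\ 0\le\theta\le\alpha\}$ be the closed double sector. For an interval $I\subseteq\mathbb{R}$, $\mathrm{AC}(I)$ denotes the functions $f$ on $I$ for which there is $g\in L^1_{\mathrm{loc}}(I)$ with $f(y)-f(x)=\int_x^y g(s)\,ds$ for all $x,y\in I$. $\mathrm{AC}_{1,2}((0,T)\times\mathbb{R})$ is the space of $\Psi:(0,T)\times\mathbb{R}\to\mathbb{C}$ such that $\Psi(\cdot,x)\in\mathrm{AC}((0,T))$ for all $x\in\mathbb{R}$, and, for all $t\in(0,T)$, $\Psi(t,\cdot)$ is differentiable with $\Psi(t,\cdot),\frac{\partial}{\partial x}\Psi(t,\cdot)\in\mathrm{AC}(\mathbb{R})$. **Assumptions on $G$.** Let $\Omega\subseteq\mathbb{C}$ be open with $S_\alpha\subseteq\Omega$, let $V:(0,T)\times\mathbb{R}\to\mathbb{C}$ be a function, and let $G:(0,T)\times\mathbb{R}\times\Omega\to\mathbb{C}$ be such that $z\mapsto G(t,x,z)$ is holomorphic on $\Omega$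 for all $t\in(0,T)$, $x\in\mathbb{R}$. Suppose: (i) For every $z\in S_\alpha$, $G(\cdot,\cdot,z)\in\mathrm{AC}_{1,2}((0,T)\times\mathbb{R})$ and $i\frac{\partial}{\partial t}G(t,x,z)=\big(-\frac{\partial^2}{\partial x^2}+V(t,x)\big)G(t,x,z)$ for a.e. $(t,x)\in(0,T)\times\mathbb{R}$. (ii) There are $a\in\mathrm{AC}((0,T))$ with $a(t)>0$ and $\lim_{t\to0^+}a(t)=\infty$, a function $\widetilde G$ with $G(t,x,z)=e^{ia(t)(z-x)^2}\widetilde G(t,x,z)$ for all $t\in(0,T)$, $x\in\mathbb{R}$, $z\in\Omega$, and continuous $A_0,B_0:(0,T)\times\mathbb{R}\to[0,\infty)$ such that $A_0/\sqrt a$ and $B_0$ extend continuously to $[0,T)\times\mathbb{R}$ and $|\widetilde G(t,x,z)|\le A_0(t,x)e^{B_0(t,x)|z|}$ for all $t\in(0,T)$, $x\in\mathbb{R}$, $z\in\Omega$. (iii) For all $x\in\mathbb{R}$ and $z\in\Omega$, $\lim_{t\to0^+}\widetilde G(t,x,z)/\sqrt{a(t)}=1/\sqrt{i\pi}$ (principal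 branch). (iv) There are functions $A_1,B_1:(0,T)\times\mathbb{R}\to[0,\infty)$, with $B_1$ continuous, $A_1(\cdot,x)\in L^1_{\mathrm{loc}}((0,T))$ for every $x\in\mathbb{R}$ and $A_1(t,\cdot)\in L^1_{\mathrm{loc}}(\mathbb{R})$ for every $t\in(0,T)$, such that for every $z\in S_\alpha$ $$\Big|\frac{\partial}{\partial x}\widetilde G(t,x,z)\Big|,\ \Big|\frac{\partial^2}{\partial x^2}\widetilde G(t,x,z)\Big|\le A_1(t,x)e^{B_1(t,x)|z|}\quad\text{for every }t\in(0,T)\text{ and a.e. }x\in\mathbb{R},$$ $$\Big|\frac{\partial}{\partial t}\widetilde G(t,x,z)\Big|\le A_1(t,x)e^{B_1(t,x)|z|}\quad\text{for every }x\in\mathbb{R}\text{ and a.e. }t\in(0,T).$$ **Theorem.** Let $F:\Omega\to\mathbb{C}$ be holomorphic with $|F(z)|\le Ae^{B|z|}$ for all $z\in\Omega$ and some $A,B\ge0$. Then for all $t\in(0,T)$ and $x\in\mathbb{R}$ the function $y\mapsto e^{-\varepsilon y^2}G(t,x,y)F(y)$ is integrable on $\mathbb{R}$ for every $\varepsilon>0$,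 the limit $$\Psi(t,x):=\lim_{\varepsilon\to0^+}\int_{\mathbb{R}}e^{-\varepsilon y^2}G(t,x,y)F(y)\,dy$$ exists, and $$\Psi(t,x)=e^{i\alpha}\int_{\mathbb{R}}G(t,x,ye^{i\alpha})F(ye^{i\alpha})\,dy,$$ where the last integral is absolutely convergent. Moreover, $\Psi\in\mathrm{AC}_{1,2}((0,T)\times\mathbb{R})$, $$i\frac{\partial}{\partial t}\Psi(t,x)=\Big(-\frac{\partial^2}{\partial x^2}+V(t,x)\Big)\Psi(t,x)\quad\text{for a.e. }(t,x)\in(0,T)\times\mathbb{R},$$ and $\lim_{t\to0^+}\Psi(t,x)=F(x)$ for every $x\in\mathbb{R}$. -/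

import Mathlib

open Filter Topology MeasureTheory

/-- The open time interval `(0, T)`, where `T ∈ (0, ∞]`. -/
def timeInterval (T : EReal) : Set ℝ := {t | 0 < t ∧ (t : EReal) < T}

/-- The half-open time interval `[0, T)`. -/
def timeIntervalZero (T : EReal) : Set ℝ := {t | 0 ≤ t ∧ (t : EReal) < T}

/-- The closed double sector of all `r e^{iθ}` with `θ ∈ [0, α]` and `r ∈ ℝ`
(negative `r` gives the arguments in `[π, π + α]`; the vertex `0` is included). -/
def doubleSector (α : ℝ) : Set ℂ :=
  {z | ∃ r θ : ℝ, 0 ≤ θ ∧ θ ≤ α ∧ z = (r : ℂ) * Complex.exp (Complex.I * (θ : ℂ))}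

/-- `f ∈ AC(I)` for an interval `I`: the increments of `f` are integrals of some
`g ∈ L¹_loc(I)`. -/
def IsACOn {E : Type*} [NormedAddCommGroup E] [NormedSpace ℝ E] (f : ℝ → E) (I : Set ℝ) : Prop :=
  ∃ g : ℝ → E, LocallyIntegrableOn g I volume ∧
    ∀ x ∈ I, ∀ y ∈ I, f y - f x = ∫ s in x..y, g s

/-- The space `AC_{1,2}((0,T) × ℝ)`. Only the values of `Ψ t x` with `t ∈ (0, T)` matter. -/
structure MemAC12 (T : EReal) (Ψ : ℝ → ℝ → ℂ) : Prop where
  time : ∀ x : ℝ, IsACOn (fun t => Ψ t x) (timeInterval T)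
  space : ∀ t ∈ timeInterval T, IsACOn (Ψ t) Set.univ
  differentiable_space : ∀ t ∈ timeInterval T, Differentiable ℝ (Ψ t)
  deriv_space : ∀ t ∈ timeInterval T, IsACOn (deriv (Ψ t)) Set.univ

/-- The equation `i ∂ₜΨ = (-∂ₓ² + V) Ψ` at almost every point of `(0,T) × ℝ`; that the
derivatives exist at almost every point is part of the meaning. -/
def SolvesSchrodinger (T : EReal) (V Ψ : ℝ → ℝ → ℂ) : Prop :=
  ∀ᵐ p : ℝ × ℝ, p.1 ∈ timeInterval T →
    DifferentiableAt ℝ (fun t => Ψ t p.2) p.1 ∧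
    DifferentiableAt ℝ (deriv (Ψ p.1)) p.2 ∧
    Complex.I * deriv (fun t => Ψ t p.2) p.1 =
      -deriv (deriv (Ψ p.1)) p.2 + V p.1 p.2 * Ψ p.1 p.2

/-- `f : (0,T) × ℝ → ℝ` extends continuously to `[0,T) × ℝ`. -/
def ExtendsContinuously (T : EReal) (f : ℝ → ℝ → ℝ) : Prop :=
  ∃ h : ℝ × ℝ → ℝ, ContinuousOn h (timeIntervalZero T ×ˢ Set.univ) ∧
    ∀ t ∈ timeInterval T, ∀ x : ℝ, h (t, x) = f t x

/-- The assumptions on the Green's function `G` (continued in its last variable to `Ω`), with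
the phase function `a`, the remainder `G'` in `G = e^{ia(t)(z-x)²} G'`, and the bounding functions
`A₀, B₀, A₁, B₁`. -/
structure GreenAssumption (T : EReal) (α : ℝ) (Ω : Set ℂ) (V : ℝ → ℝ → ℂ)
    (G : ℝ → ℝ → ℂ → ℂ) (a : ℝ → ℝ) (G' : ℝ → ℝ → ℂ → ℂ)
    (A₀ B₀ A₁ B₁ : ℝ → ℝ → ℝ) : Prop where
  holomorphic : ∀ t ∈ timeInterval T, ∀ x : ℝ, DifferentiableOn ℂ (G t x) Ω
  -- (i) regularity and the Schrödinger equation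
  memAC12 : ∀ z ∈ doubleSector α, MemAC12 T (fun t x => G t x z)
  solves : ∀ z ∈ doubleSector α, SolvesSchrodinger T V (fun t x => G t x z)
  -- (ii) the decomposition and the growth bound
  a_ac : IsACOn a (timeInterval T)
  a_pos : ∀ t ∈ timeInterval T, 0 < a t
  a_tendsto : Tendsto a (𝓝[>] 0) atTop
  decomposition : ∀ t ∈ timeInterval T, ∀ x : ℝ, ∀ z ∈ Ω,
    G t x z = Complex.exp (Complex.I * (a t : ℂ) * (z - (x : ℂ)) ^ 2) * G' t x z
  growth : ∀ t ∈ timeInterval T, ∀ x : ℝ, ∀ z ∈ Ω,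
    ‖G' t x z‖ ≤ A₀ t x * Real.exp (B₀ t x * ‖z‖)
  A₀_nonneg : ∀ t ∈ timeInterval T, ∀ x : ℝ, 0 ≤ A₀ t x
  B₀_nonneg : ∀ t ∈ timeInterval T, ∀ x : ℝ, 0 ≤ B₀ t x
  A₀_cont : ContinuousOn (fun p : ℝ × ℝ => A₀ p.1 p.2) (timeInterval T ×ˢ Set.univ)
  B₀_cont : ContinuousOn (fun p : ℝ × ℝ => B₀ p.1 p.2) (timeInterval T ×ˢ Set.univ)
  A₀_extends : ExtendsContinuously T (fun t x => A₀ t x / Real.sqrt (a t))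
  B₀_extends : ExtendsContinuously T B₀
  -- (iii) the limit as `t → 0⁺`, with the principal branch of the square root
  limit : ∀ x : ℝ, ∀ z ∈ Ω,
    Tendsto (fun t => G' t x z / (Real.sqrt (a t) : ℂ)) (𝓝[>] 0)
      (𝓝 (1 / (Complex.I * (Real.pi : ℂ)) ^ (1 / 2 : ℂ)))
  -- (iv) the bounds on the derivatives of the remainder
  A₁_nonneg : ∀ t ∈ timeInterval T, ∀ x : ℝ, 0 ≤ A₁ t x
  A₁_time : ∀ x : ℝ, LocallyIntegrableOn (fun t => A₁ t x) (timeInterval T) volume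
  A₁_space : ∀ t ∈ timeInterval T, LocallyIntegrable (A₁ t) volume
  B₁_nonneg : ∀ t ∈ timeInterval T, ∀ x : ℝ, 0 ≤ B₁ t x
  B₁_cont : ContinuousOn (fun p : ℝ × ℝ => B₁ p.1 p.2) (timeInterval T ×ˢ Set.univ)
  bound_dx : ∀ t ∈ timeInterval T, ∀ z ∈ doubleSector α, ∀ᵐ x : ℝ,
    ‖deriv (fun ξ => G' t ξ z) x‖ ≤ A₁ t x * Real.exp (B₁ t x * ‖z‖)
  bound_dxx : ∀ t ∈ timeInterval T, ∀ z ∈ doubleSector α, ∀ᵐ x : ℝ,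
    ‖deriv (deriv (fun ξ => G' t ξ z)) x‖ ≤ A₁ t x * Real.exp (B₁ t x * ‖z‖)
  bound_dt : ∀ x : ℝ, ∀ z ∈ doubleSector α, ∀ᵐ t : ℝ, t ∈ timeInterval T →
    ‖deriv (fun τ => G' τ x z) t‖ ≤ A₁ t x * Real.exp (B₁ t x * ‖z‖)

/-!
Write `Ψ` for the limit of the regularized integrals. With `k = tan α`, the integrand
`e^{-εz²} G(t, x, z) F(z)` decays like a Gaussian on the double sector swept out by the lines of
slope `s ∈ [0, k]` through the origin once `ε k ≤ a(t)`: on the line of slope `s` through a pivot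
`x₀`, the real part of `-εz² + ia(z - x)²` is at most `-εy² + s a ((x - x₀)² - (y - x)²)`
(`re_exponent_tiltedLine_le`), and the remaining factors grow at most exponentially. Hence the
contour may be tilted (`integral_eq_integral_tiltedLine`), and on the tilted line the phase alone
supplies the decay, so that `ε` can be sent to zero by dominated convergence
(`GreenAssumption.tendsto_regularized`). The same statement holds for every line that can be
reached inside `Ω` by tilting the real line about a real point, and two such lines are used.

The line through the origin at angle `α` gives the representation in the theorem and the
Schrödinger equation. Along it the time derivative of the kernel for fixed `x`, and its first two
space derivatives for fixed `t`, are bounded on compact intervals by the product of an integrable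
function of the differentiation variable with a Gaussian in `y`; under such a bound absolute
continuity passes under the integral (`integral_ac_of_dominated`). The equation then holds for `Ψ`
by superposition (`memAC12_and_solves_integral`). Two points need care. Joint measurability
is deduced from separate continuity, and derivatives are taken along a fixed sequence of increments
(`seqDeriv`), so that they are measurable in all variables. The potential `V` need not be
measurable, so that the equation cannot be integrated in `y` directly; with
`S = i ∂ₜK + ∂ₓ²K` it is replaced by the identities `S(y) K(y') = S(y') K(y)`, which do not
involve `V` and are integrated in `y` for each rational `y'`. Where `K(t, x, ·)` vanishes at all
rational points it vanishes identically, and both sides of the equation are zero.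

For the initial value at `x`, the pivot is `x` and the slope is small; such a line stays in `Ω`
because it leaves the sector only near a compact part of the real axis
(`exists_slope_tiltedLine_mem`). After the substitution `y = x + u / √a(t)` the phase is a fixed
Fresnel phase, and `G̃ / √a` converges along the moving points because a bounded family of
holomorphic functions is equicontinuous (`tendsto_apply_of_bounded_holomorphic`). The limit is a
Fresnel integral (`integral_fresnel_tilted`).
-/

/-! ### Absolute continuity and measurable derivatives -/

lemma exists_Icc_subset_of_isOpen {I : Set ℝ} (hI : IsOpen I) {x : ℝ} (hx : x ∈ I) :
    ∃ c d : ℚ, (c : ℝ) < x ∧ x < d ∧ Set.Icc (c : ℝ) d ⊆ I := by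
  obtain ⟨ε, hε, hb⟩ := Metric.isOpen_iff.1 hI x hx
  obtain ⟨c, hc1, hc2⟩ := exists_rat_btwn (show x - ε < x by linarith)
  obtain ⟨d, hd1, hd2⟩ := exists_rat_btwn (show x < x + ε by linarith)
  refine ⟨c, d, hc2, hd1, fun y hy => hb ?_⟩
  rw [Metric.mem_ball, Real.dist_eq, abs_lt]
  constructor <;> linarith [hy.1, hy.2]

lemma MeasureTheory.LocallyIntegrableOn.intervalIntegrable_of_ordConnected {E : Type*}
    [NormedAddCommGroup E] {I : Set ℝ} {g : ℝ → E}
    (hg : LocallyIntegrableOn g I volume) (hI : I.OrdConnected) {x y : ℝ} (hx : x ∈ I)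
    (hy : y ∈ I) : IntervalIntegrable g volume x y :=
  (hg.integrableOn_compact_subset (hI.uIcc_subset hx hy) isCompact_uIcc).intervalIntegrable

section AC

variable {E : Type*} [NormedAddCommGroup E] [NormedSpace ℝ E] {I : Set ℝ}

lemma continuousOn_of_sub_eq_integral {f g : ℝ → E} (hIo : IsOpen I) (hI : I.OrdConnected)
    (hg : LocallyIntegrableOn g I volume)
    (h : ∀ x ∈ I, ∀ y ∈ I, f y - f x = ∫ s in x..y, g s) : ContinuousOn f I := by
  intro x hx
  obtain ⟨c, d, hc, hd, hcd⟩ := exists_Icc_subset_of_isOpen hIo hx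
  have hcd' : (c : ℝ) ≤ d := (hc.trans hd).le
  have hcI : (c : ℝ) ∈ I := hcd ⟨le_rfl, hcd'⟩
  have hdI : (d : ℝ) ∈ I := hcd ⟨hcd', le_rfl⟩
  have h1 := intervalIntegral.continuousOn_primitive_interval'
    (hg.intervalIntegrable_of_ordConnected hI hcI hdI) (a := x)
    (by rw [Set.uIcc_of_le hcd']; exact ⟨hc.le, hd.le⟩)
  rw [Set.uIcc_of_le hcd'] at h1
  have h2 : ContinuousOn f (Set.Icc (c : ℝ) d) := by
    refine ((continuousOn_const (c := f x)).add h1).congr fun y hy => ?_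
    simp [← h x hx y (hcd hy)]
  exact (h2.continuousAt (Icc_mem_nhds hc hd)).continuousWithinAt

lemma ae_hasDerivAt_of_sub_eq_integral [CompleteSpace E] {f g : ℝ → E} (hIo : IsOpen I)
    (hI : I.OrdConnected) (hg : LocallyIntegrableOn g I volume)
    (h : ∀ x ∈ I, ∀ y ∈ I, f y - f x = ∫ s in x..y, g s) :
    ∀ᵐ x : ℝ, x ∈ I → HasDerivAt f (g x) x := by
  have key : ∀ c d : ℚ, ∀ᵐ x : ℝ, (c : ℝ) ∈ I → (d : ℝ) ∈ I → (c : ℝ) ≤ d →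
      x ∈ Set.Ioo (c : ℝ) d → HasDerivAt f (g x) x := by
    intro c d
    by_cases hc : (c : ℝ) ∈ I
    swap
    · exact Eventually.of_forall fun x h => absurd h hc
    by_cases hd : (d : ℝ) ∈ I
    swap
    · exact Eventually.of_forall fun x _ h => absurd h hd
    filter_upwards [(hg.intervalIntegrable_of_ordConnected hI hc hd).ae_hasDerivAt_integral]
      with x hx _ _ hcd hxm
    have h1 := (hx (by rw [Set.uIcc_of_le hcd]; exact ⟨hxm.1.le, hxm.2.le⟩) c
      Set.left_mem_uIcc).const_add (f c)
    refine h1.congr_of_eventuallyEq ?_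
    filter_upwards [Ioo_mem_nhds hxm.1 hxm.2] with y hy
    simp [← h c hc y (hI.out hc hd ⟨hy.1.le, hy.2.le⟩)]
  have key' := ae_all_iff.2 fun c => ae_all_iff.2 (key c)
  filter_upwards [key'] with x hx hxI
  obtain ⟨c, d, hc, hd, hcd⟩ := exists_Icc_subset_of_isOpen hIo hxI
  have hcd' : (c : ℝ) ≤ d := (hc.trans hd).le
  exact hx c d (hcd ⟨le_rfl, hcd'⟩) (hcd ⟨hcd', le_rfl⟩) hcd' ⟨hc, hd⟩

/-- Absolute continuity passes under the integral sign: if the density `D s y` of `k · y` is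
dominated, locally in `s`, by a product `b s * h y` of integrable functions, then `s ↦ ∫ k s y dy`
is absolutely continuous with density `∫ D s y dy`. Integrability of `k s` at one parameter
propagates to all others. -/
lemma integral_ac_of_dominated [CompleteSpace E] {k D : ℝ → ℝ → E} (hIo : IsOpen I)
    (hI : I.OrdConnected)
    (hD : StronglyMeasurable (Function.uncurry D))
    (hk : ∀ y, ∀ s₁ ∈ I, ∀ s₂ ∈ I, k s₂ y - k s₁ y = ∫ s in s₁..s₂, D s y)
    {s₀ : ℝ} (hs₀ : s₀ ∈ I) (hint : Integrable (k s₀))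
    (hb : ∀ c d, c ≤ d → Set.Icc c d ⊆ I → ∃ b h : ℝ → ℝ, IntegrableOn b (Set.Icc c d) ∧
      Integrable h ∧ ∀ y, ∀ᵐ s : ℝ, s ∈ Set.Icc c d → ‖D s y‖ ≤ b s * h y) :
    (∀ s ∈ I, Integrable (k s)) ∧
    LocallyIntegrableOn (fun s => ∫ y, D s y) I ∧
    (∀ s₁ ∈ I, ∀ s₂ ∈ I, (∫ y, k s₂ y) - ∫ y, k s₁ y = ∫ s in s₁..s₂, ∫ y, D s y) ∧
    ∀ᵐ s : ℝ, s ∈ I → Integrable (D s) := by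
  -- the density is integrable on every product of a compact interval with the line
  have hprod : ∀ c d, c ≤ d → Set.Icc c d ⊆ I →
      Integrable (Function.uncurry D) ((volume.restrict (Set.Icc c d)).prod volume) := by
    intro c d hcd hsub
    obtain ⟨b, h, hb1, hh1, hle⟩ := hb c d hcd hsub
    -- measurable representatives make the set on which the bound holds measurable
    obtain ⟨b', hb'm, hbb'⟩ := hb1.1
    obtain ⟨h', hh'm, hhh'⟩ := hh1.1
    have hm' : Integrable (fun p : ℝ × ℝ => b' p.1 * h' p.2)
        ((volume.restrict (Set.Icc c d)).prod volume) :=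
      (hb1.congr hbb').mul_prod (hh1.congr hhh')
    refine hm'.mono' hD.aestronglyMeasurable ?_
    have hmeas : MeasurableSet {p : ℝ × ℝ | ‖D p.1 p.2‖ ≤ b' p.1 * h' p.2} :=
      measurableSet_le hD.norm.measurable
        ((hb'm.measurable.comp measurable_fst).mul (hh'm.measurable.comp measurable_snd))
    have : ∀ᵐ y : ℝ, ∀ᵐ s ∂(volume.restrict (Set.Icc c d)), ‖D s y‖ ≤ b' s * h' y := by
      filter_upwards [hhh'] with y hy
      filter_upwards [hbb', (ae_restrict_iff' measurableSet_Icc).2 (hle y)] with s hs1 hs2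
      rw [← hs1, ← hy]; exact hs2
    exact (Measure.ae_prod_iff_ae_ae hmeas).2 ((Measure.ae_ae_comm hmeas).2 this)
  have hprod' : ∀ s₁ ∈ I, ∀ s₂ ∈ I,
      Integrable (Function.uncurry D) ((volume.restrict (Set.uIoc s₁ s₂)).prod volume) := by
    intro s₁ h1 s₂ h2
    refine (hprod (min s₁ s₂) (max s₁ s₂) min_le_max (hI.uIcc_subset h1 h2)).mono_measure ?_
    refine Measure.prod_mono (Measure.restrict_mono Set.uIoc_subset_uIcc le_rfl) le_rfl
  have hdiff : ∀ s₁ ∈ I, ∀ s₂ ∈ I, Integrable fun y => ∫ s in s₁..s₂, D s y := by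
    intro s₁ h1 s₂ h2
    simp only [intervalIntegral.intervalIntegral_eq_integral_uIoc]
    exact (hprod' s₁ h1 s₂ h2).integral_prod_right.smul _
  have hall : ∀ s ∈ I, Integrable (k s) := by
    intro s hs
    refine (hint.add (hdiff s₀ hs₀ s hs)).congr (Eventually.of_forall fun y => ?_)
    simp [← hk y s₀ hs₀ s hs]
  refine ⟨hall, ?_, ?_, ?_⟩
  · intro x hx
    obtain ⟨c, d, hc, hd, hcd⟩ := exists_Icc_subset_of_isOpen hIo hx
    exact ⟨Set.Icc (c : ℝ) d, mem_nhdsWithin_of_mem_nhds (Icc_mem_nhds hc hd),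
      (hprod c d (hc.trans hd).le hcd).integral_prod_left⟩
  · intro s₁ h1 s₂ h2
    rw [← integral_sub (hall s₂ h2) (hall s₁ h1)]
    simp only [hk _ s₁ h1 s₂ h2]
    rw [intervalIntegral_integral_swap]
    exact hprod' s₁ h1 s₂ h2
  · have key : ∀ c d : ℚ, ∀ᵐ s : ℝ, (c : ℝ) ≤ d → Set.Icc (c : ℝ) d ⊆ I →
        s ∈ Set.Icc (c : ℝ) d → Integrable (D s) := by
      intro c d
      by_cases hcd : (c : ℝ) ≤ d
      swap
      · exact Eventually.of_forall fun x h => absurd h hcd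
      by_cases hsub : Set.Icc (c : ℝ) d ⊆ I
      swap
      · exact Eventually.of_forall fun x _ h => absurd h hsub
      filter_upwards [(ae_restrict_iff' measurableSet_Icc).1 (hprod c d hcd hsub).prod_right_ae]
        with s hs _ _ hm using hs hm
    filter_upwards [ae_all_iff.2 fun c => ae_all_iff.2 (key c)] with s hs hsI
    obtain ⟨c, d, hc, hd, hcd⟩ := exists_Icc_subset_of_isOpen hIo hsI
    exact hs c d (hc.trans hd).le hcd ⟨hc.le, hd.le⟩

/-- For a jointly measurable function that is continuous in `t`, the points `(t, b)` at which a
given measurable function is its derivative in `t` form a measurable set: by continuity, it is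
enough to test the derivative on rational increments. -/
lemma measurableSet_hasDerivAt_with_param {β : Type*} [MeasurableSpace β] {Φ P : ℝ → β → ℂ}
    (hIo : IsOpen I) (hΦ : Measurable (Function.uncurry Φ)) (hP : Measurable (Function.uncurry P))
    (hc : ∀ b, ContinuousOn (fun t => Φ t b) I) :
    MeasurableSet {p : ℝ × β | p.1 ∈ I → HasDerivAt (fun t => Φ t p.2) (P p.1 p.2) p.1} := by
  have heq : {p : ℝ × β | p.1 ∈ I → HasDerivAt (fun t => Φ t p.2) (P p.1 p.2) p.1} =
      {p : ℝ × β | p.1 ∉ I} ∪ ⋂ n : ℕ, ⋃ m : ℕ, ⋂ q : ℚ, {p : ℝ × β | |(q : ℝ)| < 1 / (m + 1) →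
        ‖Φ (p.1 + q) p.2 - Φ p.1 p.2 - (q : ℂ) * P p.1 p.2‖ ≤ 1 / (n + 1) * |(q : ℝ)|} := by
    ext ⟨t, b⟩
    simp only [Set.mem_ofPred_eq, Set.mem_union, Set.mem_iInter, Set.mem_iUnion]
    rw [imp_iff_not_or]
    refine or_congr_right' fun ht => ?_
    rw [not_not] at ht
    rw [hasDerivAt_iff_isLittleO_nhds_zero, Asymptotics.isLittleO_iff]
    constructor
    · intro H n
      have H1 := H (show (0 : ℝ) < 1 / (n + 1) by positivity)
      obtain ⟨ε, hε, hb⟩ := Metric.eventually_nhds_iff.1 H1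
      obtain ⟨m, hm⟩ := exists_nat_one_div_lt hε
      refine ⟨m, fun q hq => ?_⟩
      have := hb (y := (q : ℝ)) (by rw [dist_zero_right, Real.norm_eq_abs]; exact hq.trans hm)
      rw [Real.norm_eq_abs, Complex.real_smul, Complex.ofReal_ratCast] at this
      exact this
    · intro H c hc0
      obtain ⟨n, hn⟩ := exists_nat_one_div_lt hc0
      obtain ⟨m, hm⟩ := H n
      obtain ⟨ε, hε, hball⟩ := Metric.isOpen_iff.1 hIo t ht
      have hr : 0 < min ε (1 / ((m : ℝ) + 1)) := lt_min hε (by positivity)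
      refine Metric.eventually_nhds_iff.2 ⟨_, hr, fun h hh => ?_⟩
      rw [dist_zero_right, Real.norm_eq_abs] at hh
      -- both sides of the estimate are continuous in the increment
      have hcont : ContinuousOn (fun h : ℝ => ‖Φ (t + h) b - Φ t b - (h : ℂ) * P t b‖)
          (Metric.ball 0 (min ε (1 / ((m : ℝ) + 1)))) := by
        refine ContinuousOn.norm (ContinuousOn.sub (ContinuousOn.sub ?_ continuousOn_const) ?_)
        · refine (hc b).comp (by fun_prop) fun h hh => hball ?_
          rw [Metric.mem_ball, dist_zero_right, Real.norm_eq_abs] at hh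
          rw [Metric.mem_ball, Real.dist_eq, add_sub_cancel_left]
          exact hh.trans_le (min_le_left _ _)
        · exact (by fun_prop : Continuous fun h : ℝ => (h : ℂ) * P t b).continuousOn
      have hle : ‖Φ (t + h) b - Φ t b - (h : ℂ) * P t b‖ ≤ 1 / (n + 1) * |h| := by
        by_contra hlt
        rw [not_le] at hlt
        have hmem : Metric.ball (0 : ℝ) (min ε (1 / ((m : ℝ) + 1))) ∈ 𝓝 h :=
          Metric.isOpen_ball.mem_nhds (by simpa [Real.norm_eq_abs] using hh)
        have hc2 : ContinuousAt (fun h : ℝ => (1 / ((n : ℝ) + 1)) * |h|) h := by fun_prop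
        have hev : ∀ᶠ h' in 𝓝 h, h' ∈ Metric.ball (0 : ℝ) (min ε (1 / ((m : ℝ) + 1))) ∧
            1 / ((n : ℝ) + 1) * |h'| < ‖Φ (t + h') b - Φ t b - (h' : ℂ) * P t b‖ :=
          (eventually_mem_set.2 hmem).and
            (hc2.eventually_lt (hcont.continuousAt hmem) hlt)
        obtain ⟨q, hq1, hq2⟩ : ∃ q : ℚ, (q : ℝ) ∈ Metric.ball (0 : ℝ) (min ε (1 / ((m : ℝ) + 1))) ∧
            1 / ((n : ℝ) + 1) * |(q : ℝ)| < ‖Φ (t + q) b - Φ t b - ((q : ℝ) : ℂ) * P t b‖ := by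
          obtain ⟨U, hU, hUo, hhU⟩ := eventually_nhds_iff.1 hev
          obtain ⟨q, hq⟩ := Rat.denseRange_cast.exists_mem_open hUo ⟨h, hhU⟩
          exact ⟨q, hU _ hq⟩
        rw [Metric.mem_ball, dist_zero_right, Real.norm_eq_abs] at hq1
        have := hm q (hq1.trans_le (min_le_right _ _))
        push_cast at hq2
        linarith
      simp only [Complex.real_smul]
      rw [Real.norm_eq_abs]
      exact hle.trans (mul_le_mul_of_nonneg_right hn.le (abs_nonneg _))
  rw [heq]
  refine (measurable_fst hIo.measurableSet.compl).union (MeasurableSet.iInter fun n =>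
    MeasurableSet.iUnion fun m => MeasurableSet.iInter fun q => ?_)
  by_cases hq : |(q : ℝ)| < 1 / ((m : ℝ) + 1)
  · simp only [hq, true_imp_iff]
    refine measurableSet_le (Measurable.norm (Measurable.sub (Measurable.sub ?_ hΦ) ?_))
      measurable_const
    · exact hΦ.comp ((measurable_fst.add_const _).prodMk measurable_snd)
    · exact hP.const_mul _
  · simp only [hq, false_imp_iff]
    exact MeasurableSet.univ

end AC

/-- The limit of the difference quotients of `f` at `s` along the increments `1 / (n + 1)`: it is
the derivative where that exists, and, unlike `deriv`, it is measurable in parameters without any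
continuity assumption. -/
@[irreducible] noncomputable def seqDeriv (f : ℝ → ℂ) (s : ℝ) : ℂ :=
  limUnder atTop fun n : ℕ => ((n : ℂ) + 1) * (f (s + 1 / ((n : ℝ) + 1)) - f s)

lemma HasDerivAt.tendsto_diffQuot {f : ℝ → ℂ} {f' : ℂ} {s : ℝ} (h : HasDerivAt f f' s) :
    Tendsto (fun n : ℕ => ((n : ℂ) + 1) * (f (s + 1 / ((n : ℝ) + 1)) - f s)) atTop (𝓝 f') := by
  have h1 := h.tendsto_slope_zero
  have h2 : Tendsto (fun n : ℕ => 1 / ((n : ℝ) + 1)) atTop (𝓝[≠] 0) :=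
    tendsto_nhdsWithin_iff.2 ⟨tendsto_one_div_add_atTop_nhds_zero_nat,
      Eventually.of_forall fun n => by
        have : (0 : ℝ) < 1 / ((n : ℝ) + 1) := by positivity
        exact this.ne'⟩
  refine (h1.comp h2).congr fun n => ?_
  simp

lemma HasDerivAt.seqDeriv_eq {f : ℝ → ℂ} {f' : ℂ} {s : ℝ} (h : HasDerivAt f f' s) :
    seqDeriv f s = f' := by
  rw [seqDeriv]
  exact h.tendsto_diffQuot.limUnder_eq

lemma stronglyMeasurable_seqDeriv {β : Type*} [MeasurableSpace β] {Φ : ℝ → β → ℂ}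
    (hΦ : Measurable (Function.uncurry Φ)) :
    StronglyMeasurable fun p : ℝ × β => seqDeriv (fun t => Φ t p.2) p.1 := by
  simp only [seqDeriv]
  refine StronglyMeasurable.limUnder fun n => ?_
  refine (Measurable.const_mul (Measurable.sub ?_ hΦ) _).stronglyMeasurable
  exact hΦ.comp ((measurable_fst.add_const _).prodMk measurable_snd)

/-! ### Tilting the contour of integration -/

lemma exp_neg_mul_sq_add_abs_le {c : ℝ} (hc : 0 < c) (b y : ℝ) :
    Real.exp (-c * y ^ 2 + b * |y|) ≤ Real.exp (b ^ 2 / (2 * c)) * Real.exp (-(c / 2) * y ^ 2) := by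
  rw [← Real.exp_add]
  refine Real.exp_le_exp.2 ?_
  have h : b ^ 2 / (2 * c) + -(c / 2) * y ^ 2 - (-c * y ^ 2 + b * |y|) =
      (c * |y| - b) ^ 2 / (2 * c) := by
    field_simp
    rw [← sq_abs y]
    ring
  have : 0 ≤ (c * |y| - b) ^ 2 / (2 * c) := by positivity
  linarith

lemma integrable_exp_neg_mul_sq_add_abs {c : ℝ} (hc : 0 < c) (b : ℝ) :
    Integrable fun y : ℝ => Real.exp (-c * y ^ 2 + b * |y|) := by
  refine ((integrable_exp_neg_mul_sq (half_pos hc)).const_mul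
    (Real.exp (b ^ 2 / (2 * c)))).mono' (by fun_prop) (Eventually.of_forall fun y => ?_)
  rw [Real.norm_eq_abs, abs_of_pos (Real.exp_pos _)]
  exact exp_neg_mul_sq_add_abs_le hc b y

lemma tendsto_exp_neg_mul_sq_add_abs {c : ℝ} (hc : 0 < c) (b : ℝ) :
    Tendsto (fun y : ℝ => Real.exp (-c * y ^ 2 + b * |y|)) atTop (𝓝 0) := by
  have h1 : Tendsto (fun y : ℝ => Real.exp (b ^ 2 / (2 * c)) * Real.exp (-(c / 2) * y ^ 2))
      atTop (𝓝 (Real.exp (b ^ 2 / (2 * c)) * 0)) := by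
    refine Tendsto.const_mul _ (Real.tendsto_exp_atBot.comp ?_)
    exact (tendsto_pow_atTop two_ne_zero).const_mul_atTop_of_neg (by linarith)
  rw [mul_zero] at h1
  exact squeeze_zero (fun y => (Real.exp_pos _).le) (fun y => exp_neg_mul_sq_add_abs_le hc b y) h1

/-- The point above `y` on the line of slope `s` through the real point `x₀`. -/
noncomputable def tiltedLine (x₀ s y : ℝ) : ℂ := y + s * Complex.I * (y - x₀)

lemma tiltedLine_zero_slope (x₀ y : ℝ) : tiltedLine x₀ 0 y = y := by simp [tiltedLine]

lemma continuous_tiltedLine (x₀ s : ℝ) : Continuous (tiltedLine x₀ s) := by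
  unfold tiltedLine; fun_prop

lemma tiltedLine_re (x₀ s y : ℝ) : (tiltedLine x₀ s y).re = y := by simp [tiltedLine]

lemma tiltedLine_im (x₀ s y : ℝ) : (tiltedLine x₀ s y).im = s * (y - x₀) := by simp [tiltedLine]

/-- The contour of integration may be tilted from the real line to a line of slope `k` through
`x₀`, for a holomorphic function with Gaussian decay uniformly on the double sector swept over.
This is the divergence theorem in the coordinates `(y, s)` for the vector field
`(-i (y - x₀) h, (1 + i s) h)`. -/
lemma integral_eq_integral_tiltedLine {Ω : Set ℂ} (hΩ : IsOpen Ω) {h : ℂ → ℂ}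
    (hh : DifferentiableOn ℂ h Ω) {k x₀ c b C : ℝ} (hk : 0 ≤ k) (hc : 0 < c)
    (hline : ∀ s ∈ Set.Icc 0 k, ∀ y, tiltedLine x₀ s y ∈ Ω)
    (hb : ∀ s ∈ Set.Icc 0 k, ∀ y,
      ‖h (tiltedLine x₀ s y)‖ ≤ C * Real.exp (-c * y ^ 2 + b * |y|)) :
    ∫ y : ℝ, h y = (1 + k * Complex.I) * ∫ y : ℝ, h (tiltedLine x₀ k y) := by
  have h0k : (0 : ℝ) ∈ Set.Icc 0 k := ⟨le_rfl, hk⟩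
  have hkk : k ∈ Set.Icc 0 k := ⟨hk, le_rfl⟩
  have hcontw : Continuous fun p : ℝ × ℝ => tiltedLine x₀ p.2 p.1 := by
    unfold tiltedLine; fun_prop
  set f : ℝ × ℝ → ℂ := fun p => -Complex.I * (p.1 - x₀) * h (tiltedLine x₀ p.2 p.1) with hf
  set g : ℝ × ℝ → ℂ := fun p => (1 + p.2 * Complex.I) * h (tiltedLine x₀ p.2 p.1) with hg
  have hcomp : ContinuousOn (fun p : ℝ × ℝ => h (tiltedLine x₀ p.2 p.1))
      (Set.univ ×ˢ Set.Icc 0 k) :=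
    hh.continuousOn.comp hcontw.continuousOn fun p hp => hline _ hp.2 _
  have hfst : ∀ p : ℝ × ℝ, HasFDerivAt (fun p : ℝ × ℝ => (p.1 : ℂ))
      (Complex.ofRealCLM.comp (ContinuousLinearMap.fst ℝ ℝ ℝ)) p := fun p =>
    (Complex.ofRealCLM.comp (ContinuousLinearMap.fst ℝ ℝ ℝ)).hasFDerivAt
  have hsnd : ∀ p : ℝ × ℝ, HasFDerivAt (fun p : ℝ × ℝ => (p.2 : ℂ))
      (Complex.ofRealCLM.comp (ContinuousLinearMap.snd ℝ ℝ ℝ)) p := fun p =>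
    (Complex.ofRealCLM.comp (ContinuousLinearMap.snd ℝ ℝ ℝ)).hasFDerivAt
  have hw : ∀ p : ℝ × ℝ, HasFDerivAt (fun p : ℝ × ℝ => tiltedLine x₀ p.2 p.1) _ p := fun p =>
    (hfst p).add (((hsnd p).mul_const Complex.I).mul ((hfst p).sub_const (x₀ : ℂ)))
  have hhw : ∀ p : ℝ × ℝ, p.2 ∈ Set.Icc 0 k →
      HasFDerivAt (fun p : ℝ × ℝ => h (tiltedLine x₀ p.2 p.1)) _ p := fun p hp =>
    ((hh.hasDerivAt (hΩ.mem_nhds (hline _ hp p.1))).complexToReal_fderiv).comp p (hw p)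
  have hfd : ∀ p : ℝ × ℝ, p.2 ∈ Set.Icc 0 k → HasFDerivAt f _ p := fun p hp =>
    (((hfst p).sub_const (x₀ : ℂ)).const_mul (-Complex.I)).mul (hhw p hp)
  have hgd : ∀ p : ℝ × ℝ, p.2 ∈ Set.Icc 0 k → HasFDerivAt g _ p := fun p hp =>
    (((hsnd p).mul_const Complex.I).const_add 1).mul (hhw p hp)
  have hdiv : ∀ p : ℝ × ℝ, p.2 ∈ Set.Icc 0 k →
      fderiv ℝ f p (1, 0) + fderiv ℝ g p (0, 1) = 0 := by
    intro p hp
    rw [(hfd p hp).fderiv, (hgd p hp).fderiv]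
    simp
    ring
  have hgint : ∀ s ∈ Set.Icc 0 k, Integrable fun y => g (y, s) := by
    intro s hs
    have : Integrable fun y => h (tiltedLine x₀ s y) := by
      refine ((integrable_exp_neg_mul_sq_add_abs hc b).const_mul C).mono' ?_
        (Eventually.of_forall (hb s hs))
      refine Continuous.aestronglyMeasurable ?_
      exact hh.continuousOn.comp_continuous (continuous_tiltedLine x₀ s) fun y => hline s hs y
    exact this.const_mul (1 + s * Complex.I)
  -- the flux through the two remaining sides of the box vanishes as the box grows
  have hside : ∀ R s, s ∈ Set.Icc 0 k → ‖f (R, s)‖ ≤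
      C * Real.exp |x₀| * Real.exp (-c * R ^ 2 + (b + 1) * |R|) := by
    intro R s hs
    have h1 : ‖(R : ℂ) - x₀‖ ≤ Real.exp |x₀| * Real.exp |R| := by
      rw [← Complex.ofReal_sub, Complex.norm_real, Real.norm_eq_abs, ← Real.exp_add]
      have := Real.add_one_le_exp (|x₀| + |R|)
      have := abs_sub R x₀
      linarith
    simp only [hf, norm_mul, norm_neg, Complex.norm_I, one_mul]
    calc ‖(R : ℂ) - x₀‖ * ‖h (tiltedLine x₀ s R)‖
        ≤ (Real.exp |x₀| * Real.exp |R|) * (C * Real.exp (-c * R ^ 2 + b * |R|)) :=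
          mul_le_mul h1 (hb s hs R) (norm_nonneg _) (by positivity)
      _ = C * Real.exp |x₀| * (Real.exp |R| * Real.exp (-c * R ^ 2 + b * |R|)) := by ring
      _ = _ := by rw [← Real.exp_add]; ring_nf
  have hbox : ∀ R : ℝ, 0 ≤ R → (∫ y in (-R)..R, g (y, k)) - ∫ y in (-R)..R, g (y, 0) =
      (∫ s in (0 : ℝ)..k, f (-R, s)) - ∫ s in (0 : ℝ)..k, f (R, s) := by
    intro R hR
    have hsub : Set.uIcc (-R) R ×ˢ Set.uIcc 0 k ⊆ Set.univ ×ˢ Set.Icc 0 k := by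
      rw [Set.uIcc_of_le hk]
      exact Set.prod_mono (Set.subset_univ _) le_rfl
    have hmem : ∀ p ∈ Set.Ioo (min (-R) R) (max (-R) R) ×ˢ Set.Ioo (min 0 k) (max 0 k),
        p.2 ∈ Set.Icc 0 k := by
      rintro p ⟨-, hp⟩
      rw [min_eq_left hk, max_eq_right hk] at hp
      exact ⟨hp.1.le, hp.2.le⟩
    have h0 : Set.EqOn (fun _ : ℝ × ℝ => (0 : ℂ))
        (fun p => fderiv ℝ f p (1, 0) + fderiv ℝ g p (0, 1))
        (Set.uIcc (-R) R ×ˢ Set.uIcc 0 k) := fun p hp => (hdiv p (hsub hp).2).symm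
    have := integral2_divergence_prod_of_hasFDerivAt f g (fderiv ℝ f) (fderiv ℝ g) (-R) 0 R k
      (ContinuousOn.mono ((by fun_prop : ContinuousOn
        (fun p : ℝ × ℝ => -Complex.I * (p.1 - x₀)) _).mul hcomp) hsub)
      (ContinuousOn.mono ((by fun_prop : ContinuousOn
        (fun p : ℝ × ℝ => 1 + p.2 * Complex.I) _).mul hcomp) hsub)
      (fun p hp => (hfd p (hmem p hp)).differentiableAt.hasFDerivAt)
      (fun p hp => (hgd p (hmem p hp)).differentiableAt.hasFDerivAt)
      ((integrableOn_zero).congr_fun h0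
        (measurableSet_uIcc.prod measurableSet_uIcc))
    have hz : ∫ x in (-R)..R, ∫ y in (0 : ℝ)..k,
        fderiv ℝ f (x, y) (1, 0) + fderiv ℝ g (x, y) (0, 1) = 0 := by
      rw [intervalIntegral.integral_congr (g := fun _ => 0)]
      · simp
      · intro x _
        show ∫ y in (0 : ℝ)..k, fderiv ℝ f (x, y) (1, 0) + fderiv ℝ g (x, y) (0, 1) = 0
        rw [intervalIntegral.integral_congr (g := fun _ => 0)]
        · simp
        · intro y hy
          rw [Set.uIcc_of_le hk] at hy
          exact hdiv (x, y) hy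
    rw [hz] at this
    linear_combination -this
  have hlim : ∀ σ : ℝ, σ ^ 2 = 1 →
      Tendsto (fun R : ℝ => ∫ s in (0 : ℝ)..k, f (σ * R, s)) atTop (𝓝 0) := by
    intro σ hσ
    have habs : |σ| = 1 := by
      rw [← sq_eq_sq₀ (abs_nonneg σ) zero_le_one, sq_abs, hσ, one_pow]
    have hz : Tendsto (fun R : ℝ => C * Real.exp |x₀| *
        Real.exp (-c * R ^ 2 + (b + 1) * |R|) * |k - 0|) atTop (𝓝 0) := by
      simpa using (((tendsto_exp_neg_mul_sq_add_abs hc (b + 1)).const_mul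
        (C * Real.exp |x₀|)).mul_const |k - 0|)
    refine squeeze_zero_norm (fun R => ?_) hz
    refine intervalIntegral.norm_integral_le_of_norm_le_const fun s hs => ?_
    rw [Set.uIoc_of_le hk] at hs
    have := hside (σ * R) s ⟨hs.1.le, hs.2⟩
    rwa [mul_pow, hσ, one_mul, abs_mul, habs, one_mul] at this
  have hL : Tendsto (fun R : ℝ => (∫ y in (-R)..R, g (y, k)) - ∫ y in (-R)..R, g (y, 0)) atTop
      (𝓝 ((∫ y, g (y, k)) - ∫ y, g (y, 0))) :=
    (intervalIntegral_tendsto_integral (hgint k hkk) tendsto_neg_atTop_atBot tendsto_id).sub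
      (intervalIntegral_tendsto_integral (hgint 0 h0k) tendsto_neg_atTop_atBot tendsto_id)
  have hRlim : Tendsto (fun R : ℝ => (∫ y in (-R)..R, g (y, k)) - ∫ y in (-R)..R, g (y, 0)) atTop
      (𝓝 0) := by
    have := (hlim (-1) (by norm_num)).sub (hlim 1 (by norm_num))
    rw [sub_zero] at this
    refine this.congr' ?_
    filter_upwards [eventually_ge_atTop (0 : ℝ)] with R hR
    rw [hbox R hR]
    simp
  have hfin := tendsto_nhds_unique hL hRlim
  simp only [hg, tiltedLine_zero_slope] at hfin
  rw [integral_const_mul] at hfin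
  simp only [Complex.ofReal_zero, zero_mul, add_zero, one_mul] at hfin
  linear_combination -hfin

/-- On a tilted line the modulus of `e^{-εz² + ia(z-x)²}` is governed by the real Gaussian
`e^{-εy² - sa(y-x)²}`, provided that `ε` is small compared to `a`. -/
lemma re_exponent_tiltedLine_le {ε a k s x x₀ : ℝ} (hε : 0 ≤ ε) (ha : ε * k ≤ a)
    (hs : s ∈ Set.Icc 0 k) (y : ℝ) :
    (-(ε : ℂ) * tiltedLine x₀ s y ^ 2 + Complex.I * a * (tiltedLine x₀ s y - x) ^ 2).re ≤
      -ε * y ^ 2 + s * a * ((x - x₀) ^ 2 - (y - x) ^ 2) := by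
  have h1 : (-(ε : ℂ) * tiltedLine x₀ s y ^ 2 + Complex.I * a * (tiltedLine x₀ s y - x) ^ 2).re =
      -ε * (y ^ 2 - s ^ 2 * (y - x₀) ^ 2) - a * (2 * s * (y - x) * (y - x₀)) := by
    simp [pow_two, tiltedLine_re, tiltedLine_im]
    ring
  rw [h1]
  have h2 : ε * s ^ 2 ≤ s * a := by
    have : ε * s ≤ a := (mul_le_mul_of_nonneg_left hs.2 hε).trans ha
    nlinarith [hs.1]
  have h3 := mul_le_mul_of_nonneg_right h2 (sq_nonneg (y - x₀))
  nlinarith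

/-! ### Superposition of solutions -/

lemma isOpen_timeInterval (T : EReal) : IsOpen (timeInterval T) :=
  isOpen_Ioi.inter (isOpen_Iio.preimage continuous_coe_real_ereal)

lemma ordConnected_timeInterval (T : EReal) : (timeInterval T).OrdConnected :=
  ⟨fun _ hx _ hy _ hz => ⟨hx.1.trans_le hz.1, (EReal.coe_le_coe_iff.2 hz.2).trans_lt hy.2⟩⟩

lemma eventually_mem_timeInterval {T : EReal} (hT : 0 < T) :
    ∀ᶠ t : ℝ in 𝓝[>] 0, t ∈ timeInterval T := by
  have h : ∀ᶠ t : ℝ in 𝓝 0, (t : EReal) < T :=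
    continuous_coe_real_ereal.continuousAt.eventually_lt continuousAt_const (by simpa using hT)
  filter_upwards [self_mem_nhdsWithin, mem_nhdsWithin_of_mem_nhds h] with t h1 h2 using ⟨h1, h2⟩

section IsACOn

variable {E : Type*} [NormedAddCommGroup E] [NormedSpace ℝ E] {I : Set ℝ}

lemma IsACOn.continuousOn {f : ℝ → E} (hf : IsACOn f I) (hIo : IsOpen I) (hI : I.OrdConnected) :
    ContinuousOn f I := by
  obtain ⟨g, hg, h⟩ := hf
  exact continuousOn_of_sub_eq_integral hIo hI hg h

lemma IsACOn.ae_hasDerivAt {f : ℝ → ℂ} (hf : IsACOn f I) (hIo : IsOpen I) (hI : I.OrdConnected) :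
    ∀ᵐ s : ℝ, s ∈ I → HasDerivAt f (seqDeriv f s) s := by
  obtain ⟨g, hg, h⟩ := hf
  filter_upwards [ae_hasDerivAt_of_sub_eq_integral hIo hI hg h] with s hs hsI
  rw [(hs hsI).seqDeriv_eq]
  exact hs hsI

lemma IsACOn.sub_eq_integral_seqDeriv {f : ℝ → ℂ} (hf : IsACOn f I) (hIo : IsOpen I)
    (hI : I.OrdConnected) {s₁ s₂ : ℝ} (h₁ : s₁ ∈ I) (h₂ : s₂ ∈ I) :
    f s₂ - f s₁ = ∫ s in s₁..s₂, seqDeriv f s := by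
  obtain ⟨g, hg, h⟩ := hf
  rw [h s₁ h₁ s₂ h₂]
  refine intervalIntegral.integral_congr_ae ?_
  filter_upwards [ae_hasDerivAt_of_sub_eq_integral hIo hI hg h] with s hs hsI
  exact ((hs (hI.uIcc_subset h₁ h₂ (Set.uIoc_subset_uIcc hsI))).seqDeriv_eq).symm

end IsACOn

lemma stronglyMeasurable_seqDeriv_middle {Φ : ℝ → ℝ → ℝ → ℂ}
    (hΦ : Measurable fun p : ℝ × ℝ × ℝ => Φ p.1 p.2.1 p.2.2) :
    StronglyMeasurable fun p : ℝ × ℝ × ℝ => seqDeriv (fun ξ => Φ p.1 ξ p.2.2) p.2.1 := by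
  have hswap : Measurable fun p : ℝ × ℝ × ℝ => ((p.2.1, p.1, p.2.2) : ℝ × ℝ × ℝ) :=
    (measurable_fst.comp measurable_snd).prodMk
      (measurable_fst.prodMk (measurable_snd.comp measurable_snd))
  have h1 : Measurable (Function.uncurry fun (x : ℝ) (q : ℝ × ℝ) => Φ q.1 x q.2) :=
    hΦ.comp hswap
  have h2 := stronglyMeasurable_seqDeriv h1
  exact h2.comp_measurable hswap

/-- Superposition principle: a family `K t x y` of solutions of the Schrödinger equation, indexed
by `y`, whose derivatives are dominated by integrable functions of `y` in product form, integrates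
to a solution in `AC_{1,2}`. The potential is not assumed measurable, so that it has to be
eliminated from the equation before integrating. -/
theorem memAC12_and_solves_integral {T : EReal} {V : ℝ → ℝ → ℂ} {K : ℝ → ℝ → ℝ → ℂ}
    (hmeas : Measurable fun p : ℝ × ℝ × ℝ => K p.1 p.2.1 p.2.2)
    (hzero : ∀ t ∉ timeInterval T, ∀ x y, K t x y = 0)
    (hcont : ∀ t x, Continuous (K t x))
    (htime : ∀ x y, IsACOn (fun t => K t x y) (timeInterval T))
    (hdiff : ∀ t y, Differentiable ℝ fun x => K t x y)
    (hspace : ∀ t ∈ timeInterval T, ∀ y, IsACOn (deriv fun x => K t x y) Set.univ)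
    (hint : ∀ t ∈ timeInterval T, ∀ x, Integrable (K t x))
    (hbt : ∀ x c d, c ≤ d → Set.Icc c d ⊆ timeInterval T → ∃ b h : ℝ → ℝ,
      IntegrableOn b (Set.Icc c d) ∧ Integrable h ∧
      ∀ y, ∀ᵐ t : ℝ, t ∈ Set.Icc c d → ‖deriv (fun τ => K τ x y) t‖ ≤ b t * h y)
    (hbx : ∀ t ∈ timeInterval T, ∀ c d, c ≤ d → ∃ b h : ℝ → ℝ,
      IntegrableOn b (Set.Icc c d) ∧ Integrable h ∧
      ∀ y, ∀ᵐ x : ℝ, x ∈ Set.Icc c d → ‖deriv (fun ξ => K t ξ y) x‖ ≤ b x * h y)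
    (hbxx : ∀ t ∈ timeInterval T, ∀ c d, c ≤ d → ∃ b h : ℝ → ℝ,
      IntegrableOn b (Set.Icc c d) ∧ Integrable h ∧
      ∀ y, ∀ᵐ x : ℝ, x ∈ Set.Icc c d → ‖deriv (deriv fun ξ => K t ξ y) x‖ ≤ b x * h y)
    (hsol : ∀ y, SolvesSchrodinger T V fun t x => K t x y) :
    MemAC12 T (fun t x => ∫ y, K t x y) ∧ SolvesSchrodinger T V fun t x => ∫ y, K t x y := by
  have hIo := isOpen_timeInterval T
  have hI := ordConnected_timeInterval T
  set I := timeInterval T with hIdef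
  -- the derivatives of the kernel, chosen jointly measurable
  set Dt : ℝ → ℝ → ℝ → ℂ := fun t x y => seqDeriv (fun τ => K τ x y) t with hDt
  set Dx : ℝ → ℝ → ℝ → ℂ := fun t x y => seqDeriv (fun ξ => K t ξ y) x with hDx
  set Dxx : ℝ → ℝ → ℝ → ℂ := fun t x y => seqDeriv (fun ξ => Dx t ξ y) x with hDxx
  have hDxd : ∀ t y, (fun x => Dx t x y) = deriv fun x => K t x y := fun t y =>
    funext fun x => (hdiff t y x).hasDerivAt.seqDeriv_eq
  have hKder : ∀ t x y, HasDerivAt (fun ξ => K t ξ y) (Dx t x y) x := fun t x y => by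
    have : Dx t x y = deriv (fun ξ => K t ξ y) x := congrFun (hDxd t y) x
    rw [this]
    exact (hdiff t y x).hasDerivAt
  have hDtm : StronglyMeasurable fun p : ℝ × ℝ × ℝ => Dt p.1 p.2.1 p.2.2 :=
    stronglyMeasurable_seqDeriv (Φ := fun t (q : ℝ × ℝ) => K t q.1 q.2) hmeas
  have hDxm : StronglyMeasurable fun p : ℝ × ℝ × ℝ => Dx p.1 p.2.1 p.2.2 :=
    stronglyMeasurable_seqDeriv_middle hmeas
  have hDxxm : StronglyMeasurable fun p : ℝ × ℝ × ℝ => Dxx p.1 p.2.1 p.2.2 :=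
    stronglyMeasurable_seqDeriv_middle hDxm.measurable
  have hassoc : Measurable fun p : (ℝ × ℝ) × ℝ => ((p.1.1, p.1.2, p.2) : ℝ × ℝ × ℝ) := by fun_prop
  have hΨm : StronglyMeasurable fun p : ℝ × ℝ => ∫ y, K p.1 p.2 y :=
    ((hmeas.comp hassoc).stronglyMeasurable).integral_prod_right'
  have hPtm : StronglyMeasurable fun p : ℝ × ℝ => ∫ y, Dt p.1 p.2 y :=
    (hDtm.comp_measurable hassoc).integral_prod_right'
  have hPxm : StronglyMeasurable fun p : ℝ × ℝ => ∫ y, Dx p.1 p.2 y :=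
    (hDxm.comp_measurable hassoc).integral_prod_right'
  have hPxxm : StronglyMeasurable fun p : ℝ × ℝ => ∫ y, Dxx p.1 p.2 y :=
    (hDxxm.comp_measurable hassoc).integral_prod_right'
  -- time direction
  have hT0 : ∀ x, LocallyIntegrableOn (fun t => ∫ y, Dt t x y) I ∧
      (∀ s₁ ∈ I, ∀ s₂ ∈ I, (∫ y, K s₂ x y) - ∫ y, K s₁ x y = ∫ s in s₁..s₂, ∫ y, Dt s x y) ∧
      ∀ᵐ s : ℝ, s ∈ I → Integrable (Dt s x) := by
    intro x
    by_cases hne : I.Nonempty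
    · obtain ⟨s₀, hs₀⟩ := hne
      refine (integral_ac_of_dominated (k := fun t y => K t x y) (D := fun t y => Dt t x y) hIo hI
        (hDtm.comp_measurable (by fun_prop : Measurable fun p : ℝ × ℝ => (p.1, x, p.2)))
        (fun y s₁ h₁ s₂ h₂ => (htime x y).sub_eq_integral_seqDeriv hIo hI h₁ h₂) hs₀
        (hint s₀ hs₀ x) ?_).2
      intro c d hcd hsub
      obtain ⟨b, h, hb, hh, hle⟩ := hbt x c d hcd hsub
      refine ⟨b, h, hb, hh, fun y => ?_⟩
      filter_upwards [hle y, (htime x y).ae_hasDerivAt hIo hI] with t h1 h2 ht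
      have := h1 ht
      rwa [(h2 (hsub ht)).deriv] at this
    · rw [Set.not_nonempty_iff_eq_empty] at hne
      rw [hne]
      exact ⟨fun x hx => hx.elim, fun s hs => hs.elim, Eventually.of_forall fun s hs => hs.elim⟩
  -- space direction, first derivative
  have hDxc : ∀ t ∈ I, ∀ y, Continuous fun x => Dx t x y := fun t ht y => by
    rw [hDxd, ← continuousOn_univ]
    exact (hspace t ht y).continuousOn isOpen_univ Set.ordConnected_univ
  have hX1 : ∀ t ∈ I, LocallyIntegrableOn (fun x => ∫ y, Dx t x y) Set.univ ∧
      (∀ s₁ ∈ Set.univ, ∀ s₂ ∈ Set.univ,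
        (∫ y, K t s₂ y) - ∫ y, K t s₁ y = ∫ s in s₁..s₂, ∫ y, Dx t s y) ∧
      ∀ᵐ s : ℝ, s ∈ Set.univ → Integrable (Dx t s) := by
    intro t ht
    refine (integral_ac_of_dominated (k := fun x y => K t x y) (D := fun x y => Dx t x y)
      isOpen_univ Set.ordConnected_univ
      (hDxm.comp_measurable (by fun_prop : Measurable fun p : ℝ × ℝ => (t, p.1, p.2)))
      (fun y s₁ _ s₂ _ => ?_) (Set.mem_univ 0) (hint t ht 0) ?_).2
    · exact (intervalIntegral.integral_eq_sub_of_hasDerivAt (fun x _ => hKder t x y)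
        ((hDxc t ht y).intervalIntegrable _ _)).symm
    · intro c d hcd _
      obtain ⟨b, h, hb, hh, hle⟩ := hbx t ht c d hcd
      refine ⟨b, h, hb, hh, fun y => ?_⟩
      filter_upwards [hle y] with x h1 hx
      have := h1 hx
      rwa [(hKder t x y).deriv] at this
  -- space direction, second derivative
  have hX2 : ∀ t ∈ I, LocallyIntegrableOn (fun x => ∫ y, Dxx t x y) Set.univ ∧
      (∀ s₁ ∈ Set.univ, ∀ s₂ ∈ Set.univ,
        (∫ y, Dx t s₂ y) - ∫ y, Dx t s₁ y = ∫ s in s₁..s₂, ∫ y, Dxx t s y) ∧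
      ∀ᵐ s : ℝ, s ∈ Set.univ → Integrable (Dxx t s) := by
    intro t ht
    have hac : ∀ y, IsACOn (fun x => Dx t x y) Set.univ := fun y => by
      rw [hDxd]; exact hspace t ht y
    -- almost every base point will do
    obtain ⟨x₀, hx₀⟩ := (hX1 t ht).2.2.exists
    refine (integral_ac_of_dominated (k := fun x y => Dx t x y) (D := fun x y => Dxx t x y)
      isOpen_univ Set.ordConnected_univ
      (hDxxm.comp_measurable (by fun_prop : Measurable fun p : ℝ × ℝ => (t, p.1, p.2)))
      (fun y s₁ h₁ s₂ h₂ =>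
        (hac y).sub_eq_integral_seqDeriv isOpen_univ Set.ordConnected_univ h₁ h₂)
      (Set.mem_univ x₀) (hx₀ (Set.mem_univ x₀)) ?_).2
    intro c d hcd _
    obtain ⟨b, h, hb, hh, hle⟩ := hbxx t ht c d hcd
    refine ⟨b, h, hb, hh, fun y => ?_⟩
    filter_upwards [hle y, (hac y).ae_hasDerivAt isOpen_univ Set.ordConnected_univ] with x h1 h2 hx
    have := h1 hx
    rwa [← hDxd, (h2 (Set.mem_univ x)).deriv] at this
  have hPxc : ∀ t ∈ I, Continuous fun x => ∫ y, Dx t x y := fun t ht => by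
    rw [← continuousOn_univ]
    exact continuousOn_of_sub_eq_integral isOpen_univ Set.ordConnected_univ (hX2 t ht).1
      (hX2 t ht).2.1
  have hΨx : ∀ t ∈ I, ∀ x, HasDerivAt (fun ξ => ∫ y, K t ξ y) (∫ y, Dx t x y) x := by
    intro t ht x
    have h1 : (fun ξ => ∫ y, K t ξ y) = fun ξ =>
        (∫ y, K t 0 y) + ∫ s in (0 : ℝ)..ξ, ∫ y, Dx t s y := funext fun ξ => by
      rw [← (hX1 t ht).2.1 0 (Set.mem_univ _) ξ (Set.mem_univ _)]
      ring
    rw [h1]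
    exact ((hPxc t ht).integral_hasStrictDerivAt 0 x).hasDerivAt.const_add _
  have hΨd : ∀ t ∈ I, deriv (fun ξ => ∫ y, K t ξ y) = fun x => ∫ y, Dx t x y := fun t ht =>
    funext fun x => (hΨx t ht x).deriv
  refine ⟨⟨fun x => ⟨_, (hT0 x).1, (hT0 x).2.1⟩, fun t ht => ⟨_, (hX1 t ht).1, (hX1 t ht).2.1⟩,
    fun t ht x => (hΨx t ht x).differentiableAt, fun t ht => ?_⟩, ?_⟩
  · rw [hΨd t ht]
    exact ⟨_, (hX2 t ht).1, (hX2 t ht).2.1⟩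
  -- differentiability at almost every point
  have hE1 : ∀ᵐ p : ℝ × ℝ, p.1 ∈ I →
      HasDerivAt (fun t => ∫ y, K t p.2 y) (∫ y, Dt p.1 p.2 y) p.1 := by
    have hm := measurableSet_hasDerivAt_with_param (Φ := fun t x => ∫ y, K t x y)
      (P := fun t x => ∫ y, Dt t x y) hIo hΨm.measurable hPtm.measurable (fun x =>
        continuousOn_of_sub_eq_integral hIo hI (hT0 x).1 (hT0 x).2.1)
    refine (Measure.ae_prod_iff_ae_ae hm).2 ((Measure.ae_ae_comm hm).2 (Eventually.of_forall ?_))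
    exact fun x => ae_hasDerivAt_of_sub_eq_integral hIo hI (hT0 x).1 (hT0 x).2.1
  have hE2 : ∀ᵐ p : ℝ × ℝ, p.1 ∈ I →
      HasDerivAt (fun x => ∫ y, Dx p.1 x y) (∫ y, Dxx p.1 p.2 y) p.2 := by
    have hcx : ∀ t, ContinuousOn (fun x => ∫ y, Dx t x y) Set.univ := by
      intro t
      by_cases ht : t ∈ I
      · exact (hPxc t ht).continuousOn
      · have h0 : ∀ x y, Dx t x y = 0 := fun x y => by
          have : (fun ξ => K t ξ y) = fun _ => 0 := funext fun ξ => hzero t ht ξ y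
          simp only [hDx, this]
          exact (hasDerivAt_const x (0 : ℂ)).seqDeriv_eq
        simp only [h0, integral_zero]
        exact continuousOn_const
    have hm := measurableSet_hasDerivAt_with_param (Φ := fun x t => ∫ y, Dx t x y)
      (P := fun x t => ∫ y, Dxx t x y) isOpen_univ (hPxm.measurable.comp measurable_swap)
      (hPxxm.measurable.comp measurable_swap) hcx
    have hm2 : MeasurableSet {p : ℝ × ℝ | p.1 ∈ I →
        HasDerivAt (fun x => ∫ y, Dx p.1 x y) (∫ y, Dxx p.1 p.2 y) p.2} := by
      have : {p : ℝ × ℝ | p.1 ∈ I →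
          HasDerivAt (fun x => ∫ y, Dx p.1 x y) (∫ y, Dxx p.1 p.2 y) p.2} =
          (Prod.fst ⁻¹' I)ᶜ ∪ Prod.swap ⁻¹' {p : ℝ × ℝ | p.1 ∈ Set.univ →
            HasDerivAt (fun x => ∫ y, Dx p.2 x y) (∫ y, Dxx p.2 p.1 y) p.1} := by
        ext p
        simp [imp_iff_not_or]
      rw [this]
      exact (measurable_fst hIo.measurableSet).compl.union (measurable_swap hm)
    refine (Measure.ae_prod_iff_ae_ae hm2).2 (Eventually.of_forall fun t => ?_)
    by_cases ht : t ∈ I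
    · filter_upwards [ae_hasDerivAt_of_sub_eq_integral isOpen_univ Set.ordConnected_univ
        (hX2 t ht).1 (hX2 t ht).2.1] with x hx _ using hx (Set.mem_univ x)
    · exact Eventually.of_forall fun x h => absurd h ht
  have hE3 : ∀ᵐ p : ℝ × ℝ, p.1 ∈ I → Integrable (Dt p.1 p.2) ∧ Integrable (Dxx p.1 p.2) := by
    have hmt : MeasurableSet {p : ℝ × ℝ | p.1 ∈ I → Integrable (Dt p.1 p.2)} :=
      (measurable_fst hIo.measurableSet).imp (measurableSet_integrable (μ := (volume : Measure ℝ))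
        (f := fun (p : ℝ × ℝ) y => Dt p.1 p.2 y) (hDtm.comp_measurable hassoc))
    have hmx : MeasurableSet {p : ℝ × ℝ | p.1 ∈ I → Integrable (Dxx p.1 p.2)} :=
      (measurable_fst hIo.measurableSet).imp (measurableSet_integrable (μ := (volume : Measure ℝ))
        (f := fun (p : ℝ × ℝ) y => Dxx p.1 p.2 y) (hDxxm.comp_measurable hassoc))
    have h1 : ∀ᵐ p : ℝ × ℝ, p.1 ∈ I → Integrable (Dt p.1 p.2) :=
      (Measure.ae_prod_iff_ae_ae hmt).2 ((Measure.ae_ae_comm hmt).2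
        (Eventually.of_forall fun x => (hT0 x).2.2))
    have h2 : ∀ᵐ p : ℝ × ℝ, p.1 ∈ I → Integrable (Dxx p.1 p.2) := by
      refine (Measure.ae_prod_iff_ae_ae hmx).2 (Eventually.of_forall fun t => ?_)
      by_cases ht : t ∈ I
      · filter_upwards [(hX2 t ht).2.2] with x hx _ using hx (Set.mem_univ x)
      · exact Eventually.of_forall fun x h => absurd h ht
    filter_upwards [h1, h2] with p hp1 hp2 hp using ⟨hp1 hp, hp2 hp⟩
  -- the equation for each fixed value of the parameter
  set S : ℝ × ℝ → ℝ → ℂ := fun p y => Complex.I * Dt p.1 p.2 y + Dxx p.1 p.2 y with hS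
  have hSm : Measurable fun q : (ℝ × ℝ) × ℝ => S q.1 q.2 :=
    ((hDtm.comp_measurable hassoc).measurable.const_mul _).add
      (hDxxm.comp_measurable hassoc).measurable
  have hKm : Measurable fun q : (ℝ × ℝ) × ℝ => K q.1.1 q.1.2 q.2 := hmeas.comp hassoc
  have hbase : ∀ y, ∀ᵐ p : ℝ × ℝ, p.1 ∈ I → S p y = V p.1 p.2 * K p.1 p.2 y := by
    intro y
    filter_upwards [hsol y] with p hp hpI
    obtain ⟨h1, h2, h3⟩ := hp hpI
    have e1 : Dt p.1 p.2 y = deriv (fun t => K t p.2 y) p.1 := h1.hasDerivAt.seqDeriv_eq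
    have e2 : Dxx p.1 p.2 y = deriv (deriv fun x => K p.1 x y) p.2 := by
      simp only [hDxx, hDxd]
      exact h2.hasDerivAt.seqDeriv_eq
    simp only [hS, e1, e2]
    linear_combination h3
  -- the potential is eliminated before the Fubini exchange of `p` and `y`
  have hE4 : ∀ᵐ p : ℝ × ℝ, ∀ r : ℚ, ∀ᵐ y : ℝ, p.1 ∈ I →
      S p y * K p.1 p.2 r = S p r * K p.1 p.2 y := by
    refine ae_all_iff.2 fun r => ?_
    have hr : Measurable fun q : (ℝ × ℝ) × ℝ => ((q.1, (r : ℝ)) : (ℝ × ℝ) × ℝ) := by fun_prop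
    have hm : MeasurableSet {q : (ℝ × ℝ) × ℝ | q.1.1 ∈ I →
        S q.1 q.2 * K q.1.1 q.1.2 r = S q.1 r * K q.1.1 q.1.2 q.2} :=
      ((measurable_fst.comp measurable_fst) hIo.measurableSet).imp
        (measurableSet_eq_fun (hSm.mul (hKm.comp hr)) ((hSm.comp hr).mul hKm))
    refine (Measure.ae_ae_comm hm).2 (Eventually.of_forall fun y => ?_)
    filter_upwards [hbase y, hbase r] with p h1 h2 hp
    rw [h1 hp, h2 hp]
    ring
  have hE5 : ∀ᵐ p : ℝ × ℝ, ∀ᵐ y : ℝ, p.1 ∈ I → K p.1 p.2 y = 0 → S p y = 0 := by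
    have hm : MeasurableSet {q : (ℝ × ℝ) × ℝ | q.1.1 ∈ I → K q.1.1 q.1.2 q.2 = 0 →
        S q.1 q.2 = 0} :=
      ((measurable_fst.comp measurable_fst) hIo.measurableSet).imp
        ((measurableSet_eq_fun hKm measurable_const).imp (measurableSet_eq_fun hSm measurable_const))
    refine (Measure.ae_ae_comm hm).2 (Eventually.of_forall fun y => ?_)
    filter_upwards [hbase y] with p h1 hp h0
    rw [h1 hp, h0, mul_zero]
  filter_upwards [hE1, hE2, hE3, hE4, hE5, ae_all_iff.2 fun r : ℚ => hbase r]
    with p h1 h2 h3 h4 h5 h6 hp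
  refine ⟨(h1 hp).differentiableAt, ?_, ?_⟩
  · rw [hΨd p.1 hp]
    exact (h2 hp).differentiableAt
  · rw [hΨd p.1 hp, (h1 hp).deriv, (h2 hp).deriv]
    have hSint : ∫ y, S p y = Complex.I * (∫ y, Dt p.1 p.2 y) + ∫ y, Dxx p.1 p.2 y := by
      simp only [hS]
      rw [integral_add ((h3 hp).1.const_mul _) (h3 hp).2, integral_const_mul]
    suffices h : ∫ y, S p y = V p.1 p.2 * ∫ y, K p.1 p.2 y by
      rw [hSint] at h
      linear_combination h
    by_cases hex : ∃ r : ℚ, K p.1 p.2 r ≠ 0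
    · obtain ⟨r, hr⟩ := hex
      refine mul_right_cancel₀ hr ?_
      rw [← integral_mul_const, integral_congr_ae ((h4 r).mono fun y hy => hy hp),
        integral_const_mul, h6 r hp]
      ring
    · push Not at hex
      have hK0 : K p.1 p.2 = fun _ => 0 :=
        (hcont p.1 p.2).ext_on Rat.denseRange_cast continuous_const
          (by rintro _ ⟨r, rfl⟩; exact hex r)
      have hS0 : ∫ y, S p y = 0 := by
        rw [integral_congr_ae (g := fun _ => 0) (h5.mono fun y hy => hy hp (by rw [hK0]))]
        simp
      rw [hS0, hK0]
      simp

/-! ### The regularized integrals -/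

section Sector

variable {α : ℝ}

lemma mul_exp_mem_doubleSector (hα0 : 0 < α) (y : ℝ) :
    (y : ℂ) * Complex.exp (Complex.I * (α : ℂ)) ∈ doubleSector α :=
  ⟨y, α, hα0.le, le_rfl, rfl⟩

lemma ofReal_mem_doubleSector (hα0 : 0 < α) (y : ℝ) : (y : ℂ) ∈ doubleSector α :=
  ⟨y, 0, le_rfl, hα0.le, by simp⟩

lemma mem_doubleSector_of_slope (hα0 : 0 < α) (hα1 : α < Real.pi / 2) {s : ℝ} (hs0 : 0 ≤ s)
    (hs : s ≤ Real.tan α) {z : ℂ} (hz : z.im = s * z.re) : z ∈ doubleSector α := by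
  refine ⟨z.re * √(1 + s ^ 2), Real.arctan s, Real.arctan_nonneg.2 hs0, ?_, ?_⟩
  · rw [← Real.arctan_tan (by linarith [Real.pi_pos]) hα1]
    exact Real.arctan_mono hs
  · have h0 : √(1 + s ^ 2) ≠ 0 := by positivity
    rw [mul_comm Complex.I, Complex.exp_mul_I, ← Complex.ofReal_cos, ← Complex.ofReal_sin,
      Real.cos_arctan, Real.sin_arctan]
    apply Complex.ext
    · simp [-Complex.ofReal_add, -Complex.ofReal_mul]
      field_simp
    · simp [hz]
      field_simp

lemma tiltedLine_mem_doubleSector (hα0 : 0 < α) (hα1 : α < Real.pi / 2) {s : ℝ}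
    (hs : s ∈ Set.Icc 0 (Real.tan α)) (y : ℝ) : tiltedLine 0 s y ∈ doubleSector α :=
  mem_doubleSector_of_slope hα0 hα1 hs.1 hs.2 (by simp [tiltedLine_re, tiltedLine_im])

/-- Lines of small slope through a real point `x` stay in any open set containing the double
sector: far from the vertex they lie in the sector itself, and near it they are close to the real
line. -/
lemma exists_slope_tiltedLine_mem (hα0 : 0 < α) (hα1 : α < Real.pi / 2) {Ω : Set ℂ}
    (hΩ : IsOpen Ω) (hSΩ : doubleSector α ⊆ Ω) (x : ℝ) :
    ∃ k : ℝ, 0 < k ∧ ∀ s ∈ Set.Icc 0 k, ∀ y, tiltedLine x s y ∈ Ω := by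
  set R := |x| + 1 with hR
  have hR0 : 0 < R := by positivity
  have hxR : |x| ≤ R := by linarith
  have hK : IsCompact ((fun y : ℝ => (y : ℂ)) '' Set.Icc (-R) R) :=
    isCompact_Icc.image Complex.continuous_ofReal
  have hKΩ : ((fun y : ℝ => (y : ℂ)) '' Set.Icc (-R) R) ⊆ Ω := by
    rintro _ ⟨y, -, rfl⟩
    exact hSΩ (ofReal_mem_doubleSector hα0 y)
  obtain ⟨δ, hδ, hδΩ⟩ := hK.exists_thickening_subset_open hΩ hKΩ
  have htan : 0 < Real.tan α := Real.tan_pos_of_pos_of_lt_pi_div_two hα0 hα1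
  refine ⟨min (Real.tan α / 2) (δ / (4 * R)), by positivity, fun s hs y => ?_⟩
  have hs1 : s ≤ Real.tan α / 2 := hs.2.trans (min_le_left _ _)
  have hs2 : s ≤ δ / (4 * R) := hs.2.trans (min_le_right _ _)
  by_cases hy : |y| ≤ R
  · refine hδΩ (Metric.mem_thickening_iff.2 ⟨y, ⟨y, abs_le.1 hy, rfl⟩, ?_⟩)
    rw [dist_eq_norm]
    have : tiltedLine x s y - y = ((s * (y - x) : ℝ) : ℂ) * Complex.I := by
      simp [tiltedLine]; ring
    rw [this, norm_mul, Complex.norm_I, mul_one, Complex.norm_real, Real.norm_eq_abs, abs_mul,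
      abs_of_nonneg hs.1]
    have h1 : |y - x| ≤ 2 * R := (abs_sub y x).trans (by linarith)
    calc s * |y - x| ≤ δ / (4 * R) * (2 * R) := mul_le_mul hs2 h1 (abs_nonneg _) (by positivity)
      _ = δ / 2 := by field_simp; norm_num
      _ < δ := by linarith
  · rw [not_le] at hy
    have hy0 : y ≠ 0 := by
      rintro rfl
      simp at hy
      linarith
    have hxy : |x / y| ≤ 1 := by
      rw [abs_div, div_le_one (abs_pos.2 hy0)]
      linarith
    have h1 := abs_le.1 hxy
    refine hSΩ (mem_doubleSector_of_slope hα0 hα1 (s := s * (1 - x / y))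
      (mul_nonneg hs.1 (by linarith)) ?_ ?_)
    · calc s * (1 - x / y) ≤ Real.tan α / 2 * 2 :=
            mul_le_mul hs1 (by linarith) (by linarith) (by positivity)
        _ = Real.tan α := by ring
    · rw [tiltedLine_re, tiltedLine_im]
      field_simp

end Sector

lemma norm_tiltedLine_le {x₀ s k : ℝ} (hs : s ∈ Set.Icc 0 k) (y : ℝ) :
    ‖tiltedLine x₀ s y‖ ≤ (1 + k) * |y| + k * |x₀| := by
  have h1 : ‖tiltedLine x₀ s y‖ ≤ |y| + s * |y - x₀| := by
    refine (Complex.norm_le_abs_re_add_abs_im _).trans_eq ?_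
    rw [tiltedLine_re, tiltedLine_im, abs_mul, abs_of_nonneg hs.1]
  have h2 : s * |y - x₀| ≤ k * (|y| + |x₀|) :=
    mul_le_mul hs.2 (abs_sub y x₀) (abs_nonneg _) (hs.1.trans hs.2)
  linarith

section Contour

variable {T : EReal} {α : ℝ} {Ω : Set ℂ} {V : ℝ → ℝ → ℂ} {G : ℝ → ℝ → ℂ → ℂ} {a : ℝ → ℝ}
  {G' : ℝ → ℝ → ℂ → ℂ} {A₀ B₀ A₁ B₁ : ℝ → ℝ → ℝ} {F : ℂ → ℂ} {A B : ℝ} {t : ℝ}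

lemma GreenAssumption.norm_regularized_le (hG : GreenAssumption T α Ω V G a G' A₀ B₀ A₁ B₁)
    (hA : 0 ≤ A) (hB : 0 ≤ B) (hFb : ∀ z ∈ Ω, ‖F z‖ ≤ A * Real.exp (B * ‖z‖))
    (ht : t ∈ timeInterval T) (x : ℝ) {x₀ ε k s : ℝ} (hε : 0 ≤ ε) (hεk : ε * k ≤ a t)
    (hs : s ∈ Set.Icc 0 k) (y : ℝ) (hz : tiltedLine x₀ s y ∈ Ω) :
    ‖Complex.exp (-(ε : ℂ) * tiltedLine x₀ s y ^ 2) * G t x (tiltedLine x₀ s y) *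
        F (tiltedLine x₀ s y)‖ ≤
      A₀ t x * A * Real.exp (-ε * y ^ 2 + s * a t * ((x - x₀) ^ 2 - (y - x) ^ 2) +
        (B₀ t x + B) * ((1 + k) * |y| + k * |x₀|)) := by
  set z := tiltedLine x₀ s y with hzdef
  have hB0 := hG.B₀_nonneg t ht x
  have hA0 := hG.A₀_nonneg t ht x
  have hn : ‖z‖ ≤ (1 + k) * |y| + k * |x₀| := norm_tiltedLine_le hs y
  have h1 : ‖G' t x z‖ ≤ A₀ t x * Real.exp (B₀ t x * ((1 + k) * |y| + k * |x₀|)) :=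
    (hG.growth t ht x z hz).trans (by gcongr)
  have h2 : ‖F z‖ ≤ A * Real.exp (B * ((1 + k) * |y| + k * |x₀|)) :=
    (hFb z hz).trans (by gcongr)
  have h3 : ‖Complex.exp (-(ε : ℂ) * z ^ 2 + Complex.I * a t * (z - x) ^ 2)‖ ≤
      Real.exp (-ε * y ^ 2 + s * a t * ((x - x₀) ^ 2 - (y - x) ^ 2)) := by
    rw [Complex.norm_exp]
    exact Real.exp_le_exp.2 (re_exponent_tiltedLine_le hε hεk hs y)
  have h4 : Complex.exp (-(ε : ℂ) * z ^ 2) * G t x z * F z =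
      Complex.exp (-(ε : ℂ) * z ^ 2 + Complex.I * a t * (z - x) ^ 2) * (G' t x z * F z) := by
    rw [hG.decomposition t ht x z hz, Complex.exp_add]
    ring
  rw [h4, norm_mul, norm_mul]
  calc _ ≤ Real.exp (-ε * y ^ 2 + s * a t * ((x - x₀) ^ 2 - (y - x) ^ 2)) *
        ((A₀ t x * Real.exp (B₀ t x * ((1 + k) * |y| + k * |x₀|))) *
          (A * Real.exp (B * ((1 + k) * |y| + k * |x₀|)))) := by gcongr
    _ = A₀ t x * A * (Real.exp (-ε * y ^ 2 + s * a t * ((x - x₀) ^ 2 - (y - x) ^ 2)) *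
        (Real.exp (B₀ t x * ((1 + k) * |y| + k * |x₀|)) *
          Real.exp (B * ((1 + k) * |y| + k * |x₀|)))) := by ring
    _ = _ := by rw [← Real.exp_add, ← Real.exp_add, ← add_mul]

lemma GreenAssumption.differentiableOn_regularized
    (hG : GreenAssumption T α Ω V G a G' A₀ B₀ A₁ B₁) (hF : DifferentiableOn ℂ F Ω)
    (ht : t ∈ timeInterval T) (x : ℝ) (ε : ℝ) :
    DifferentiableOn ℂ (fun z => Complex.exp (-(ε : ℂ) * z ^ 2) * G t x z * F z) Ω :=
  ((by fun_prop : DifferentiableOn ℂ (fun z => Complex.exp (-(ε : ℂ) * z ^ 2)) Ω).mul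
    (hG.holomorphic t ht x)).mul hF

/-- On the swept sector the regularized integrand is bounded by a Gaussian of width governed by
`ε`. -/
lemma GreenAssumption.norm_regularized_le_sweep
    (hG : GreenAssumption T α Ω V G a G' A₀ B₀ A₁ B₁)
    (hA : 0 ≤ A) (hB : 0 ≤ B) (hFb : ∀ z ∈ Ω, ‖F z‖ ≤ A * Real.exp (B * ‖z‖))
    (ht : t ∈ timeInterval T) (x : ℝ) {x₀ ε k s : ℝ} (hε : 0 ≤ ε) (hεk : ε * k ≤ a t)
    (hs : s ∈ Set.Icc 0 k) (y : ℝ) (hz : tiltedLine x₀ s y ∈ Ω) :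
    ‖Complex.exp (-(ε : ℂ) * tiltedLine x₀ s y ^ 2) * G t x (tiltedLine x₀ s y) *
        F (tiltedLine x₀ s y)‖ ≤
      A₀ t x * A * Real.exp (k * a t * (x - x₀) ^ 2 + (B₀ t x + B) * (k * |x₀|)) *
        Real.exp (-ε * y ^ 2 + (B₀ t x + B) * (1 + k) * |y|) := by
  refine (hG.norm_regularized_le hA hB hFb ht x hε hεk hs y hz).trans ?_
  rw [mul_assoc (A₀ t x * A), ← Real.exp_add]
  refine mul_le_mul_of_nonneg_left (Real.exp_le_exp.2 ?_) (mul_nonneg (hG.A₀_nonneg t ht x) hA)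
  have ha := (hG.a_pos t ht).le
  have h1 : s * a t * (x - x₀) ^ 2 ≤ k * a t * (x - x₀) ^ 2 := by gcongr; exact hs.2
  have h2 : 0 ≤ s * a t * (y - x) ^ 2 := by have := hs.1; positivity
  nlinarith

/-- On the fully tilted line the Gaussian decay comes from the phase and is uniform in `ε`. -/
lemma GreenAssumption.norm_regularized_le_tilted
    (hG : GreenAssumption T α Ω V G a G' A₀ B₀ A₁ B₁)
    (hA : 0 ≤ A) (hB : 0 ≤ B) (hFb : ∀ z ∈ Ω, ‖F z‖ ≤ A * Real.exp (B * ‖z‖))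
    (ht : t ∈ timeInterval T) (x : ℝ) {x₀ ε k : ℝ} (hε : 0 ≤ ε) (hεk : ε * k ≤ a t)
    (hk : 0 ≤ k) (y : ℝ) (hz : tiltedLine x₀ k y ∈ Ω) :
    ‖Complex.exp (-(ε : ℂ) * tiltedLine x₀ k y ^ 2) * G t x (tiltedLine x₀ k y) *
        F (tiltedLine x₀ k y)‖ ≤
      A₀ t x * A * Real.exp (k * a t * (x - x₀) ^ 2 + (B₀ t x + B) * (k * |x₀|)) *
        Real.exp (-(k * a t) * y ^ 2 + (2 * (k * a t) * |x| + (B₀ t x + B) * (1 + k)) * |y|) := by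
  refine (hG.norm_regularized_le hA hB hFb ht x hε hεk ⟨hk, le_rfl⟩ y hz).trans ?_
  rw [mul_assoc (A₀ t x * A), ← Real.exp_add]
  refine mul_le_mul_of_nonneg_left (Real.exp_le_exp.2 ?_) (mul_nonneg (hG.A₀_nonneg t ht x) hA)
  have ha : 0 ≤ k * a t := mul_nonneg hk (hG.a_pos t ht).le
  have h1 : x * y ≤ |x| * |y| := by rw [← abs_mul]; exact le_abs_self _
  have h2 : 0 ≤ ε * y ^ 2 := by positivity
  have h3 := mul_le_mul_of_nonneg_left h1 ha
  nlinarith [mul_nonneg ha (sq_nonneg x)]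

lemma GreenAssumption.integrable_tiltedLine
    (hG : GreenAssumption T α Ω V G a G' A₀ B₀ A₁ B₁) (hF : DifferentiableOn ℂ F Ω)
    (hA : 0 ≤ A) (hB : 0 ≤ B) (hFb : ∀ z ∈ Ω, ‖F z‖ ≤ A * Real.exp (B * ‖z‖))
    (ht : t ∈ timeInterval T) (x : ℝ) {x₀ k : ℝ} (hk : 0 < k)
    (hline : ∀ y, tiltedLine x₀ k y ∈ Ω) :
    Integrable fun y => G t x (tiltedLine x₀ k y) * F (tiltedLine x₀ k y) := by
  have ha := hG.a_pos t ht
  refine ((integrable_exp_neg_mul_sq_add_abs (mul_pos hk ha)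
    (2 * (k * a t) * |x| + (B₀ t x + B) * (1 + k))).const_mul (A₀ t x * A *
      Real.exp (k * a t * (x - x₀) ^ 2 + (B₀ t x + B) * (k * |x₀|)))).mono' ?_
    (Eventually.of_forall fun y => ?_)
  · exact (((hG.holomorphic t ht x).mul hF).continuousOn.comp_continuous
      (continuous_tiltedLine x₀ k) hline).aestronglyMeasurable
  · have := hG.norm_regularized_le_tilted hA hB hFb ht x (ε := 0) le_rfl
      (by rw [zero_mul]; exact ha.le) hk.le y (hline y)
    simpa using this

lemma GreenAssumption.integrable_regularized
    (hG : GreenAssumption T α Ω V G a G' A₀ B₀ A₁ B₁) (hα0 : 0 < α) (hSΩ : doubleSector α ⊆ Ω)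
    (hF : DifferentiableOn ℂ F Ω)
    (hA : 0 ≤ A) (hB : 0 ≤ B) (hFb : ∀ z ∈ Ω, ‖F z‖ ≤ A * Real.exp (B * ‖z‖))
    (ht : t ∈ timeInterval T) (x : ℝ) {ε : ℝ} (hε : 0 < ε) :
    Integrable fun y : ℝ => (Real.exp (-ε * y ^ 2) : ℂ) * G t x (y : ℂ) * F (y : ℂ) := by
  have hΩr : ∀ y : ℝ, (y : ℂ) ∈ Ω := fun y => hSΩ (ofReal_mem_doubleSector hα0 y)
  have heq : ∀ y : ℝ, (Real.exp (-ε * y ^ 2) : ℂ) = Complex.exp (-(ε : ℂ) * (y : ℂ) ^ 2) :=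
    fun y => by push_cast; rfl
  simp only [heq]
  refine ((integrable_exp_neg_mul_sq_add_abs hε ((B₀ t x + B) * (1 + 0))).const_mul
    (A₀ t x * A * Real.exp (0 * a t * (x - 0) ^ 2 + (B₀ t x + B) * (0 * |0|)))).mono' ?_
    (Eventually.of_forall fun y => ?_)
  · exact ((hG.differentiableOn_regularized hF ht x ε).continuousOn.comp_continuous
      Complex.continuous_ofReal hΩr).aestronglyMeasurable
  · have := hG.norm_regularized_le_sweep hA hB hFb ht x (x₀ := 0) (k := 0) (s := 0) hε.le
      (by rw [mul_zero]; exact (hG.a_pos t ht).le) ⟨le_rfl, le_rfl⟩ y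
      (by rw [tiltedLine_zero_slope]; exact hΩr y)
    rwa [tiltedLine_zero_slope] at this

/-- The limit of the regularized integrals is the integral over any tilted line which can be
reached from the real line inside `Ω`. -/
lemma GreenAssumption.tendsto_regularized
    (hG : GreenAssumption T α Ω V G a G' A₀ B₀ A₁ B₁) (hΩ : IsOpen Ω)
    (hF : DifferentiableOn ℂ F Ω)
    (hA : 0 ≤ A) (hB : 0 ≤ B) (hFb : ∀ z ∈ Ω, ‖F z‖ ≤ A * Real.exp (B * ‖z‖))
    (ht : t ∈ timeInterval T) (x : ℝ) {x₀ k : ℝ} (hk : 0 < k)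
    (hline : ∀ s ∈ Set.Icc 0 k, ∀ y, tiltedLine x₀ s y ∈ Ω) :
    Tendsto (fun ε : ℝ => ∫ y : ℝ, (Real.exp (-ε * y ^ 2) : ℂ) * G t x (y : ℂ) * F (y : ℂ))
      (𝓝[>] 0) (𝓝 ((1 + k * Complex.I) *
        ∫ y : ℝ, G t x (tiltedLine x₀ k y) * F (tiltedLine x₀ k y))) := by
  have ha := hG.a_pos t ht
  have hkk : k ∈ Set.Icc 0 k := ⟨hk.le, le_rfl⟩
  have hsmall : ∀ᶠ ε : ℝ in 𝓝[>] 0, 0 < ε ∧ ε * k ≤ a t := by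
    refine (eventually_mem_nhdsWithin).and ?_
    have : ∀ᶠ ε : ℝ in 𝓝 0, ε < a t / k := eventually_lt_nhds (by positivity)
    filter_upwards [mem_nhdsWithin_of_mem_nhds this] with ε hε
    exact ((lt_div_iff₀ hk).1 hε).le
  have hlim : Tendsto (fun ε : ℝ => (1 + k * Complex.I) * ∫ y : ℝ,
      Complex.exp (-(ε : ℂ) * tiltedLine x₀ k y ^ 2) * G t x (tiltedLine x₀ k y) *
        F (tiltedLine x₀ k y)) (𝓝[>] 0) (𝓝 ((1 + k * Complex.I) *
        ∫ y : ℝ, G t x (tiltedLine x₀ k y) * F (tiltedLine x₀ k y))) := by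
    refine Tendsto.const_mul _ ?_
    refine tendsto_integral_filter_of_dominated_convergence _ ?_ ?_
      ((integrable_exp_neg_mul_sq_add_abs (mul_pos hk ha)
        (2 * (k * a t) * |x| + (B₀ t x + B) * (1 + k))).const_mul (A₀ t x * A *
          Real.exp (k * a t * (x - x₀) ^ 2 + (B₀ t x + B) * (k * |x₀|)))) ?_
    · exact Eventually.of_forall fun ε =>
        ((hG.differentiableOn_regularized hF ht x ε).continuousOn.comp_continuous
          (continuous_tiltedLine x₀ k) (hline k hkk)).aestronglyMeasurable
    · filter_upwards [hsmall] with ε hε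
      exact Eventually.of_forall fun y =>
        hG.norm_regularized_le_tilted hA hB hFb ht x hε.1.le hε.2 hk.le y (hline k hkk y)
    · refine Eventually.of_forall fun y => ?_
      have hc : Continuous fun ε : ℝ => Complex.exp (-(ε : ℂ) * tiltedLine x₀ k y ^ 2) *
          G t x (tiltedLine x₀ k y) * F (tiltedLine x₀ k y) := by fun_prop
      have := (hc.tendsto 0).mono_left (nhdsWithin_le_nhds (s := Set.Ioi 0))
      simpa using this
  refine hlim.congr' ?_
  filter_upwards [hsmall] with ε hε
  rw [← integral_eq_integral_tiltedLine hΩ (hG.differentiableOn_regularized hF ht x ε) hk.le hε.1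
    hline fun s hs y =>
      hG.norm_regularized_le_sweep hA hB hFb ht x hε.1.le hε.2 hs y (hline s hs y)]
  refine integral_congr_ae (Eventually.of_forall fun y => ?_)
  push_cast
  rfl

end Contour

/-- The line of slope `tan α` through the origin is the real line rotated by `α`. -/
lemma tiltedLine_tan {α : ℝ} (hα0 : 0 < α) (hα1 : α < Real.pi / 2) (y : ℝ) :
    tiltedLine 0 (Real.tan α) (Real.cos α * y) = y * Complex.exp (Complex.I * α) := by
  have hc : Real.cos α ≠ 0 := (Real.cos_pos_of_mem_Ioo ⟨by linarith [Real.pi_pos], hα1⟩).ne'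
  rw [mul_comm Complex.I, Complex.exp_mul_I, ← Complex.ofReal_cos, ← Complex.ofReal_sin]
  apply Complex.ext
  · simp [tiltedLine_re, -Complex.ofReal_cos, -Complex.ofReal_sin, mul_comm]
  · rw [tiltedLine_im, Real.tan_eq_sin_div_cos]
    simp [-Complex.ofReal_cos, -Complex.ofReal_sin]
    field_simp

lemma integral_tiltedLine_tan {α : ℝ} (hα0 : 0 < α) (hα1 : α < Real.pi / 2) (φ : ℂ → ℂ) :
    (1 + Real.tan α * Complex.I) * ∫ y : ℝ, φ (tiltedLine 0 (Real.tan α) y) =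
      Complex.exp (Complex.I * α) * ∫ y : ℝ, φ (y * Complex.exp (Complex.I * α)) := by
  have hc : 0 < Real.cos α := Real.cos_pos_of_mem_Ioo ⟨by linarith [Real.pi_pos], hα1⟩
  have h1 := Measure.integral_comp_mul_left
    (fun y : ℝ => φ (tiltedLine 0 (Real.tan α) y)) (Real.cos α)
  simp only [tiltedLine_tan hα0 hα1] at h1
  rw [h1, abs_of_pos (by positivity), mul_comm Complex.I, Complex.exp_mul_I,
    ← Complex.ofReal_cos, ← Complex.ofReal_sin, Real.tan_eq_sin_div_cos, Complex.real_smul,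
    ← mul_assoc]
  congr 1
  have hc' : (Real.cos α : ℂ) ≠ 0 := by exact_mod_cast hc.ne'
  push_cast [-Complex.ofReal_cos, -Complex.ofReal_sin]
  field_simp

/-! ### The kernel on the rotated line -/

lemma IsACOn.const_mul {f : ℝ → ℂ} {I : Set ℝ} (hf : IsACOn f I) (c : ℂ) :
    IsACOn (fun t => c * f t) I := by
  obtain ⟨g, hg, h⟩ := hf
  refine ⟨fun t => c * g t, fun x hx => ?_, fun x hx y hy => ?_⟩
  · obtain ⟨U, hU, hgU⟩ := hg x hx
    exact ⟨U, hU, hgU.const_mul c⟩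
  · rw [intervalIntegral.integral_const_mul, ← h x hx y hy]
    ring

lemma IsACOn.congr {f₁ f₂ : ℝ → ℂ} {I : Set ℝ} (hf : IsACOn f₁ I) (h : Set.EqOn f₁ f₂ I) :
    IsACOn f₂ I := by
  obtain ⟨g, hg, hfg⟩ := hf
  exact ⟨g, hg, fun x hx y hy => by rw [← h hx, ← h hy, hfg x hx y hy]⟩

lemma exists_nonneg_bound_on_Icc {f : ℝ → ℝ} {c d : ℝ} (hf : ContinuousOn f (Set.Icc c d)) :
    ∃ M, 0 ≤ M ∧ ∀ t ∈ Set.Icc c d, f t ≤ M := by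
  obtain ⟨M, hM⟩ := isCompact_Icc.bddAbove_image hf
  exact ⟨max M 0, le_max_right _ _, fun t ht =>
    (hM (Set.mem_image_of_mem f ht)).trans (le_max_left _ _)⟩

lemma exists_pos_lower_bound_on_Icc {f : ℝ → ℝ} {c d : ℝ} (hcd : c ≤ d)
    (hf : ContinuousOn f (Set.Icc c d)) (hpos : ∀ t ∈ Set.Icc c d, 0 < f t) :
    ∃ m, 0 < m ∧ ∀ t ∈ Set.Icc c d, m ≤ f t := by
  obtain ⟨t₀, ht₀, h⟩ := isCompact_Icc.exists_isMinOn (Set.nonempty_Icc.2 hcd) hf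
  exact ⟨f t₀, hpos t₀ ht₀, fun t ht => h ht⟩

lemma norm_ofReal_mul_exp (α y : ℝ) : ‖(y : ℂ) * Complex.exp (Complex.I * (α : ℂ))‖ = |y| := by
  rw [norm_mul, mul_comm Complex.I, Complex.norm_exp_ofReal_mul_I, mul_one, Complex.norm_real,
    Real.norm_eq_abs]

lemma norm_phase_rotated (α a x y : ℝ) :
    ‖Complex.exp (Complex.I * (a : ℂ) *
      ((y : ℂ) * Complex.exp (Complex.I * (α : ℂ)) - (x : ℂ)) ^ 2)‖ =
      Real.exp (-(a * Real.sin (2 * α)) * y ^ 2 + 2 * a * Real.sin α * (x * y)) := by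
  rw [Complex.norm_exp, mul_comm Complex.I (α : ℂ), Complex.exp_mul_I, ← Complex.ofReal_cos,
    ← Complex.ofReal_sin, Real.sin_two_mul]
  congr 1
  simp [pow_two, -Complex.ofReal_cos, -Complex.ofReal_sin]
  ring

/-- Uniform Gaussian bound along the rotated line: the phase absorbs the exponential growth of the
factor `p` and of `F`, locally uniformly in `a` and `x`. -/
lemma norm_rotated_le {α a a₁ a₂ x X y M β A B : ℝ} {p f : ℂ} (hα0 : 0 < α)
    (hα1 : α < Real.pi / 2) (ha₁ : 0 < a₁) (ha1 : a₁ ≤ a) (ha2 : a ≤ a₂) (hx : |x| ≤ X)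
    (hβ : 0 ≤ β) (hp : ‖p‖ ≤ β * Real.exp (M * |y|) * Real.exp (2 * (|y| + X)))
    (hf : ‖f‖ ≤ A * Real.exp (B * |y|)) :
    ‖Complex.exp (Complex.I * (α : ℂ)) * (Complex.exp (Complex.I * (a : ℂ) *
        ((y : ℂ) * Complex.exp (Complex.I * (α : ℂ)) - (x : ℂ)) ^ 2) * p * f)‖ ≤
      β * (A * Real.exp (2 * X) * Real.exp (-(a₁ * Real.sin (2 * α)) * y ^ 2 +
        (B + 2 * a₂ * X + M + 2) * |y|)) := by
  have hm : 0 ≤ Real.sin (2 * α) :=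
    Real.sin_nonneg_of_nonneg_of_le_pi (by linarith) (by linarith)
  have h1 : Real.exp (-(a * Real.sin (2 * α)) * y ^ 2 + 2 * a * Real.sin α * (x * y)) ≤
      Real.exp (-(a₁ * Real.sin (2 * α)) * y ^ 2 + 2 * a₂ * X * |y|) := by
    refine Real.exp_le_exp.2 (add_le_add ?_ ?_)
    · have : a₁ * Real.sin (2 * α) * y ^ 2 ≤ a * Real.sin (2 * α) * y ^ 2 := by gcongr
      linarith
    · have h2 : Real.sin α * (x * y) ≤ X * |y| := by
        refine (le_abs_self _).trans ?_
        rw [abs_mul, abs_mul]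
        calc |Real.sin α| * (|x| * |y|) ≤ 1 * (X * |y|) := by
              gcongr
              exact Real.abs_sin_le_one α
          _ = X * |y| := one_mul _
      have h3 : 0 ≤ X * |y| := mul_nonneg ((abs_nonneg x).trans hx) (abs_nonneg y)
      have h4 := mul_le_mul_of_nonneg_left h2 (ha₁.le.trans ha1)
      have h5 := mul_le_mul_of_nonneg_right ha2 h3
      nlinarith
  rw [norm_mul, norm_mul, norm_mul, norm_phase_rotated, mul_comm Complex.I,
    Complex.norm_exp_ofReal_mul_I, one_mul]
  -- a negative constant cannot bound a norm
  have hA : 0 ≤ A := by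
    by_contra hneg
    have := (norm_nonneg f).trans hf
    have h6 := Real.exp_pos (B * |y|)
    nlinarith
  calc _ ≤ Real.exp (-(a₁ * Real.sin (2 * α)) * y ^ 2 + 2 * a₂ * X * |y|) *
        (β * Real.exp (M * |y|) * Real.exp (2 * (|y| + X))) * (A * Real.exp (B * |y|)) := by gcongr
    _ = β * (A * (Real.exp (-(a₁ * Real.sin (2 * α)) * y ^ 2 + 2 * a₂ * X * |y|) *
        Real.exp (M * |y|) * Real.exp (2 * (|y| + X)) * Real.exp (B * |y|))) := by ring
    _ = _ := by
      rw [← Real.exp_add, ← Real.exp_add, ← Real.exp_add, mul_assoc A, ← Real.exp_add]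
      ring_nf

/-- The integrand of the absolutely convergent representation of the wave function, extended by
zero to times outside `(0, T)`. -/
noncomputable def rotatedKernel (T : EReal) (α : ℝ) (G : ℝ → ℝ → ℂ → ℂ) (F : ℂ → ℂ)
    (t x y : ℝ) : ℂ :=
  (timeInterval T).indicator (fun t => Complex.exp (Complex.I * (α : ℂ)) *
    (G t x ((y : ℂ) * Complex.exp (Complex.I * (α : ℂ))) *
      F ((y : ℂ) * Complex.exp (Complex.I * (α : ℂ))))) t

section Kernel

variable {T : EReal} {α : ℝ} {Ω : Set ℂ} {V : ℝ → ℝ → ℂ} {G : ℝ → ℝ → ℂ → ℂ} {a : ℝ → ℝ}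
  {G' : ℝ → ℝ → ℂ → ℂ} {A₀ B₀ A₁ B₁ : ℝ → ℝ → ℝ} {F : ℂ → ℂ} {A B : ℝ} {t : ℝ}

lemma rotatedKernel_of_mem (ht : t ∈ timeInterval T) (x y : ℝ) :
    rotatedKernel T α G F t x y = Complex.exp (Complex.I * (α : ℂ)) *
      (G t x ((y : ℂ) * Complex.exp (Complex.I * (α : ℂ))) *
        F ((y : ℂ) * Complex.exp (Complex.I * (α : ℂ)))) :=
  Set.indicator_of_mem ht _

lemma rotatedKernel_of_notMem (ht : t ∉ timeInterval T) (x y : ℝ) :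
    rotatedKernel T α G F t x y = 0 :=
  Set.indicator_of_notMem ht _

lemma rotatedKernel_eq_const_mul (ht : t ∈ timeInterval T) (x y : ℝ) :
    rotatedKernel T α G F t x y = (Complex.exp (Complex.I * (α : ℂ)) *
      F ((y : ℂ) * Complex.exp (Complex.I * (α : ℂ)))) *
        G t x ((y : ℂ) * Complex.exp (Complex.I * (α : ℂ))) := by
  rw [rotatedKernel_of_mem ht]
  ring

lemma GreenAssumption.isACOn_rotatedKernel_time (hG : GreenAssumption T α Ω V G a G' A₀ B₀ A₁ B₁)
    (hα0 : 0 < α) (x y : ℝ) : IsACOn (fun t => rotatedKernel T α G F t x y) (timeInterval T) :=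
  (((hG.memAC12 _ (mul_exp_mem_doubleSector hα0 y)).time x).const_mul _).congr
    fun _ ht => (rotatedKernel_eq_const_mul ht x y).symm

lemma GreenAssumption.differentiable_rotatedKernel
    (hG : GreenAssumption T α Ω V G a G' A₀ B₀ A₁ B₁) (hα0 : 0 < α) (t y : ℝ) :
    Differentiable ℝ fun x => rotatedKernel T α G F t x y := by
  by_cases ht : t ∈ timeInterval T
  · simp only [rotatedKernel_eq_const_mul ht]
    exact ((hG.memAC12 _ (mul_exp_mem_doubleSector hα0 y)).differentiable_space t ht).const_mul _
  · simp only [rotatedKernel_of_notMem ht]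
    exact differentiable_const 0

lemma GreenAssumption.deriv_rotatedKernel_space
    (hG : GreenAssumption T α Ω V G a G' A₀ B₀ A₁ B₁) (hα0 : 0 < α) (ht : t ∈ timeInterval T)
    (y : ℝ) : (deriv fun x => rotatedKernel T α G F t x y) = fun x =>
      (Complex.exp (Complex.I * (α : ℂ)) * F ((y : ℂ) * Complex.exp (Complex.I * (α : ℂ)))) *
        deriv (fun ξ => G t ξ ((y : ℂ) * Complex.exp (Complex.I * (α : ℂ)))) x := by
  funext x
  simp only [rotatedKernel_eq_const_mul ht]
  exact deriv_const_mul _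
    ((hG.memAC12 _ (mul_exp_mem_doubleSector hα0 y)).differentiable_space t ht x)

lemma GreenAssumption.isACOn_deriv_rotatedKernel
    (hG : GreenAssumption T α Ω V G a G' A₀ B₀ A₁ B₁) (hα0 : 0 < α) (ht : t ∈ timeInterval T)
    (y : ℝ) : IsACOn (deriv fun x => rotatedKernel T α G F t x y) Set.univ := by
  rw [hG.deriv_rotatedKernel_space hα0 ht]
  exact ((hG.memAC12 _ (mul_exp_mem_doubleSector hα0 y)).deriv_space t ht).const_mul _

lemma GreenAssumption.solves_rotatedKernel
    (hG : GreenAssumption T α Ω V G a G' A₀ B₀ A₁ B₁) (hα0 : 0 < α) (y : ℝ) :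
    SolvesSchrodinger T V fun t x => rotatedKernel T α G F t x y := by
  filter_upwards [hG.solves _ (mul_exp_mem_doubleSector hα0 y)] with p hp ht
  obtain ⟨h1, h2, h3⟩ := hp ht
  have hev : (fun t => rotatedKernel T α G F t p.2 y) =ᶠ[𝓝 p.1] fun t =>
      (Complex.exp (Complex.I * (α : ℂ)) * F ((y : ℂ) * Complex.exp (Complex.I * (α : ℂ)))) *
        G t p.2 ((y : ℂ) * Complex.exp (Complex.I * (α : ℂ))) := by
    filter_upwards [(isOpen_timeInterval T).mem_nhds ht] with t ht'
    exact rotatedKernel_eq_const_mul ht' p.2 y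
  refine ⟨(h1.const_mul _).congr_of_eventuallyEq hev, ?_, ?_⟩
  · rw [hG.deriv_rotatedKernel_space hα0 ht]
    exact h2.const_mul _
  · rw [hev.deriv_eq, hG.deriv_rotatedKernel_space hα0 ht, rotatedKernel_eq_const_mul ht,
      deriv_const_mul _ h1, deriv_const_mul _ h2]
    linear_combination (Complex.exp (Complex.I * (α : ℂ)) *
      F ((y : ℂ) * Complex.exp (Complex.I * (α : ℂ)))) * h3

lemma GreenAssumption.continuous_rotatedKernel
    (hG : GreenAssumption T α Ω V G a G' A₀ B₀ A₁ B₁) (hα0 : 0 < α) (hSΩ : doubleSector α ⊆ Ω)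
    (hF : DifferentiableOn ℂ F Ω) (t x : ℝ) : Continuous (rotatedKernel T α G F t x) := by
  have hc : Continuous fun y : ℝ => (y : ℂ) * Complex.exp (Complex.I * (α : ℂ)) := by fun_prop
  have hm : ∀ y : ℝ, (y : ℂ) * Complex.exp (Complex.I * (α : ℂ)) ∈ Ω := fun y =>
    hSΩ (mul_exp_mem_doubleSector hα0 y)
  by_cases ht : t ∈ timeInterval T
  · have : rotatedKernel T α G F t x = _ := funext fun y => rotatedKernel_of_mem ht x y
    rw [this]
    exact (((hG.holomorphic t ht x).mul hF).continuousOn.comp_continuous hc hm).const_mul _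
  · have : rotatedKernel T α G F t x = fun _ => 0 :=
      funext fun y => rotatedKernel_of_notMem ht x y
    rw [this]
    exact continuous_const

/-- Joint measurability of the kernel, from its continuity in each variable separately. -/
lemma GreenAssumption.measurable_rotatedKernel
    (hG : GreenAssumption T α Ω V G a G' A₀ B₀ A₁ B₁) (hα0 : 0 < α) (hSΩ : doubleSector α ⊆ Ω)
    (hF : DifferentiableOn ℂ F Ω) :
    Measurable fun p : ℝ × ℝ × ℝ => rotatedKernel T α G F p.1 p.2.1 p.2.2 := by
  set u : timeInterval T → ℝ × ℝ → ℂ := fun t q => rotatedKernel T α G F t q.1 q.2 with hu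
  have hcont : ∀ q, Continuous fun t => u t q := fun q =>
    continuousOn_iff_continuous_domRestrict.1 ((hG.isACOn_rotatedKernel_time hα0 q.1 q.2).continuousOn
      (isOpen_timeInterval T) (ordConnected_timeInterval T))
  have hmeas : ∀ t, StronglyMeasurable (u t) := fun t =>
    stronglyMeasurable_uncurry_of_continuous_of_stronglyMeasurable
      (u := fun x y => rotatedKernel T α G F t x y)
      (fun y => (hG.differentiable_rotatedKernel hα0 t y).continuous)
      (fun x => (hG.continuous_rotatedKernel hα0 hSΩ hF t x).stronglyMeasurable)
  have hum : Measurable (Function.uncurry u) :=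
    (stronglyMeasurable_uncurry_of_continuous_of_stronglyMeasurable hcont hmeas).measurable
  have hemb : MeasurableEmbedding
      (Prod.map Subtype.val id : timeInterval T × (ℝ × ℝ) → ℝ × (ℝ × ℝ)) :=
    (MeasurableEmbedding.subtype_coe (isOpen_timeInterval T).measurableSet).prodMap
      MeasurableEmbedding.id
  have heq : (fun p : ℝ × ℝ × ℝ => rotatedKernel T α G F p.1 p.2.1 p.2.2) =
      Function.extend (Prod.map Subtype.val id) (Function.uncurry u) fun _ => 0 := by
    funext p
    by_cases ht : p.1 ∈ timeInterval T
    · exact (hemb.injective.extend_apply (Function.uncurry u) _ (⟨p.1, ht⟩, p.2)).symm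
    · rw [Function.extend_apply' _ _ _ (by rintro ⟨q, rfl⟩; exact ht q.1.2),
        rotatedKernel_of_notMem ht]
  rw [heq]
  exact hemb.measurable_extend hum measurable_const

end Kernel

/-! ### Domination of the derivatives of the kernel -/

lemma le_exp_two_mul {Q : ℝ} (hQ : 0 ≤ Q) :
    1 ≤ Real.exp (2 * Q) ∧ Q ≤ Real.exp (2 * Q) ∧ Q ^ 2 ≤ Real.exp (2 * Q) := by
  have h1 : Q ≤ Real.exp Q := by linarith [Real.add_one_le_exp Q]
  have h2 : Real.exp (2 * Q) = Real.exp Q ^ 2 := by rw [← Real.exp_nat_mul]; norm_num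
  have h3 : 1 ≤ Real.exp Q := Real.one_le_exp hQ
  refine ⟨Real.one_le_exp (by positivity), ?_, ?_⟩
  · rw [h2]; nlinarith
  · rw [h2]; gcongr

section Derivatives

variable {T : EReal} {α : ℝ} {Ω : Set ℂ} {V : ℝ → ℝ → ℂ} {G : ℝ → ℝ → ℂ → ℂ} {a : ℝ → ℝ}
  {G' : ℝ → ℝ → ℂ → ℂ} {A₀ B₀ A₁ B₁ : ℝ → ℝ → ℝ} {F : ℂ → ℂ} {A B : ℝ} {t : ℝ}

lemma GreenAssumption.remainder_eq (hG : GreenAssumption T α Ω V G a G' A₀ B₀ A₁ B₁)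
    (ht : t ∈ timeInterval T) (x : ℝ) {z : ℂ} (hz : z ∈ Ω) :
    G' t x z = Complex.exp (-(Complex.I * (a t : ℂ) * (z - (x : ℂ)) ^ 2)) * G t x z := by
  rw [hG.decomposition t ht x z hz, ← mul_assoc, ← Complex.exp_add, neg_add_cancel,
    Complex.exp_zero, one_mul]

/-- The time derivative of `G` in terms of that of the remainder; `a` and `G` are differentiable at
almost every time, and then so is the remainder. -/
lemma GreenAssumption.time_deriv_eq (hG : GreenAssumption T α Ω V G a G' A₀ B₀ A₁ B₁)
    (ht : t ∈ timeInterval T) {x : ℝ} {z : ℂ} (hz : z ∈ Ω) {a' : ℝ} {g : ℂ}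
    (ha : HasDerivAt a a' t) (hg : HasDerivAt (fun τ => G τ x z) g t) :
    g = Complex.exp (Complex.I * (a t : ℂ) * (z - (x : ℂ)) ^ 2) *
      (Complex.I * a' * (z - x) ^ 2 * G' t x z + deriv (fun τ => G' τ x z) t) := by
  have hev : (fun τ => G' τ x z) =ᶠ[𝓝 t] fun τ =>
      Complex.exp (-(Complex.I * (a τ : ℂ) * (z - (x : ℂ)) ^ 2)) * G τ x z := by
    filter_upwards [(isOpen_timeInterval T).mem_nhds ht] with τ hτ
    exact hG.remainder_eq hτ x hz
  have hd : HasDerivAt (fun τ =>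
      Complex.exp (-(Complex.I * (a τ : ℂ) * (z - (x : ℂ)) ^ 2)) * G τ x z) _ t :=
    ((((ha.ofReal_comp.const_mul Complex.I).mul_const ((z - (x : ℂ)) ^ 2)).neg.cexp).mul hg)
  rw [hev.deriv_eq, hd.deriv, hG.remainder_eq ht x hz]
  have he : Complex.exp (Complex.I * (a t : ℂ) * (z - (x : ℂ)) ^ 2) *
      Complex.exp (-(Complex.I * (a t : ℂ) * (z - (x : ℂ)) ^ 2)) = 1 := by
    rw [← Complex.exp_add, add_neg_cancel, Complex.exp_zero]
  linear_combination (-g) * he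

lemma GreenAssumption.deriv_remainder_space (hG : GreenAssumption T α Ω V G a G' A₀ B₀ A₁ B₁)
    (ht : t ∈ timeInterval T) {z : ℂ} (hz : z ∈ doubleSector α) (hzΩ : z ∈ Ω) :
    deriv (fun ξ => G' t ξ z) = fun ξ : ℝ =>
      Complex.exp (-(Complex.I * (a t : ℂ) * (z - (ξ : ℂ)) ^ 2)) *
        (deriv (fun ξ => G t ξ z) ξ + 2 * Complex.I * a t * (z - ξ) * G t ξ z) := by
  funext x
  have hphase : HasDerivAt
      (fun ξ : ℝ => Complex.exp (-(Complex.I * (a t : ℂ) * (z - (ξ : ℂ)) ^ 2))) _ x :=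
    (((((hasDerivAt_id x).ofReal_comp.const_sub z).pow 2).const_mul
      (Complex.I * (a t : ℂ))).neg.cexp)
  have hd := hphase.mul (((hG.memAC12 z hz).differentiable_space t ht x).hasDerivAt)
  have heq : (fun ξ => G' t ξ z) = fun ξ : ℝ =>
      Complex.exp (-(Complex.I * (a t : ℂ) * (z - (ξ : ℂ)) ^ 2)) * G t ξ z :=
    funext fun ξ => hG.remainder_eq ht ξ hzΩ
  rw [heq]
  refine hd.deriv.trans ?_
  simp
  ring

lemma GreenAssumption.space_deriv_eq (hG : GreenAssumption T α Ω V G a G' A₀ B₀ A₁ B₁)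
    (ht : t ∈ timeInterval T) {z : ℂ} (hz : z ∈ doubleSector α) (hzΩ : z ∈ Ω) (x : ℝ) :
    deriv (fun ξ => G t ξ z) x = Complex.exp (Complex.I * (a t : ℂ) * (z - (x : ℂ)) ^ 2) *
      (-(2 * Complex.I * a t * (z - x)) * G' t x z + deriv (fun ξ => G' t ξ z) x) := by
  rw [hG.deriv_remainder_space ht hz hzΩ, hG.remainder_eq ht x hzΩ]
  have he : Complex.exp (Complex.I * (a t : ℂ) * (z - (x : ℂ)) ^ 2) *
      Complex.exp (-(Complex.I * (a t : ℂ) * (z - (x : ℂ)) ^ 2)) = 1 := by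
    rw [← Complex.exp_add, add_neg_cancel, Complex.exp_zero]
  linear_combination (-(deriv (fun ξ => G t ξ z) x)) * he

lemma GreenAssumption.space_deriv_deriv_eq (hG : GreenAssumption T α Ω V G a G' A₀ B₀ A₁ B₁)
    (ht : t ∈ timeInterval T) {z : ℂ} (hz : z ∈ doubleSector α) (hzΩ : z ∈ Ω) {x : ℝ}
    (hx : DifferentiableAt ℝ (deriv fun ξ => G t ξ z) x) :
    deriv (deriv fun ξ => G t ξ z) x =
      Complex.exp (Complex.I * (a t : ℂ) * (z - (x : ℂ)) ^ 2) *
        (deriv (deriv fun ξ => G' t ξ z) x -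
          4 * Complex.I * a t * (z - x) * deriv (fun ξ => G' t ξ z) x +
          (2 * Complex.I * a t + (2 * Complex.I * a t * (z - x)) ^ 2) * G' t x z) := by
  have hlin : HasDerivAt (fun ξ : ℝ => z - (ξ : ℂ)) (-1) x := by
    simpa using (hasDerivAt_id x).ofReal_comp.const_sub z
  have hphase := (((hlin.pow 2).const_mul (Complex.I * (a t : ℂ))).neg.cexp)
  have hd := hphase.mul (hx.hasDerivAt.add ((hlin.const_mul (2 * Complex.I * (a t : ℂ))).mul
    (((hG.memAC12 z hz).differentiable_space t ht x).hasDerivAt)))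
  have hdd := (congrArg (deriv · x) (hG.deriv_remainder_space ht hz hzΩ)).trans hd.deriv
  simp only at hdd
  rw [hdd, hG.deriv_remainder_space ht hz hzΩ, hG.remainder_eq ht x hzΩ]
  have he : Complex.exp (Complex.I * (a t : ℂ) * (z - (x : ℂ)) ^ 2) *
      Complex.exp (-(Complex.I * (a t : ℂ) * (z - (x : ℂ)) ^ 2)) = 1 := by
    rw [← Complex.exp_add, add_neg_cancel, Complex.exp_zero]
  simp
  linear_combination (-(deriv (deriv fun ξ => G t ξ z) x)) * he

lemma norm_ofReal_mul_exp_sub_le {α x y X : ℝ} (hx : |x| ≤ X) :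
    ‖(y : ℂ) * Complex.exp (Complex.I * (α : ℂ)) - (x : ℂ)‖ ≤ |y| + X := by
  refine (norm_sub_le _ _).trans ?_
  rw [norm_ofReal_mul_exp, Complex.norm_real, Real.norm_eq_abs]
  linarith

/-- Domination of the time derivative of the kernel, locally uniformly in time. -/
lemma GreenAssumption.exists_bound_time (hG : GreenAssumption T α Ω V G a G' A₀ B₀ A₁ B₁)
    (hα0 : 0 < α) (hα1 : α < Real.pi / 2) (hSΩ : doubleSector α ⊆ Ω)
    (hFb : ∀ z ∈ Ω, ‖F z‖ ≤ A * Real.exp (B * ‖z‖))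
    (x c d : ℝ) (hcd : c ≤ d) (hsub : Set.Icc c d ⊆ timeInterval T) :
    ∃ b h : ℝ → ℝ, IntegrableOn b (Set.Icc c d) ∧ Integrable h ∧
      ∀ y, ∀ᵐ t : ℝ, t ∈ Set.Icc c d →
        ‖deriv (fun τ => rotatedKernel T α G F τ x y) t‖ ≤ b t * h y := by
  have hIo := isOpen_timeInterval T
  have hI := ordConnected_timeInterval T
  have hac := (hG.a_ac.continuousOn hIo hI).mono hsub
  have hslice : ∀ {f : ℝ → ℝ → ℝ}, ContinuousOn (fun p : ℝ × ℝ => f p.1 p.2)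
      (timeInterval T ×ˢ Set.univ) → ContinuousOn (fun t => f t x) (Set.Icc c d) := fun hf =>
    hf.comp (f := fun t => (t, x)) (by fun_prop) fun t ht => ⟨hsub ht, Set.mem_univ _⟩
  obtain ⟨a₁, ha₁, ha1⟩ := exists_pos_lower_bound_on_Icc hcd hac fun t ht => hG.a_pos t (hsub ht)
  obtain ⟨a₂, -, ha2⟩ := exists_nonneg_bound_on_Icc hac
  obtain ⟨M₀, hM₀, hA0⟩ := exists_nonneg_bound_on_Icc (hslice hG.A₀_cont)
  obtain ⟨M₁, hM₁, hB0⟩ := exists_nonneg_bound_on_Icc (hslice hG.B₀_cont)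
  obtain ⟨M₂, hM₂, hB1⟩ := exists_nonneg_bound_on_Icc (hslice hG.B₁_cont)
  obtain ⟨a', ha'int, ha'⟩ := hG.a_ac
  have hsin : 0 < Real.sin (2 * α) := Real.sin_pos_of_pos_of_lt_pi (by linarith) (by linarith)
  refine ⟨fun t => |a' t| * M₀ + A₁ t x, fun y => A * Real.exp (2 * |x|) *
    Real.exp (-(a₁ * Real.sin (2 * α)) * y ^ 2 + (B + 2 * a₂ * |x| + (M₁ + M₂) + 2) * |y|),
    ?_, ?_, fun y => ?_⟩
  · refine Integrable.add ?_ ?_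
    · exact (ha'int.integrableOn_compact_subset hsub isCompact_Icc).abs.mul_const M₀
    · exact (hG.A₁_time x).integrableOn_compact_subset hsub isCompact_Icc
  · exact (integrable_exp_neg_mul_sq_add_abs (mul_pos ha₁ hsin) _).const_mul _
  set z : ℂ := (y : ℂ) * Complex.exp (Complex.I * (α : ℂ)) with hz
  have hzS : z ∈ doubleSector α := mul_exp_mem_doubleSector hα0 y
  have hzn : ‖z‖ = |y| := norm_ofReal_mul_exp α y
  filter_upwards [ae_hasDerivAt_of_sub_eq_integral hIo hI ha'int ha',
    ((hG.memAC12 z hzS).time x).ae_hasDerivAt hIo hI, hG.bound_dt x z hzS] with t h1 h2 h3 htcd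
  have ht := hsub htcd
  have hKd : deriv (fun τ => rotatedKernel T α G F τ x y) t =
      Complex.exp (Complex.I * (α : ℂ)) * (Complex.exp (Complex.I * (a t : ℂ) * (z - (x : ℂ)) ^ 2) *
        (Complex.I * a' t * (z - x) ^ 2 * G' t x z + deriv (fun τ => G' τ x z) t) * F z) := by
    have hev : (fun τ => rotatedKernel T α G F τ x y) =ᶠ[𝓝 t]
        fun τ => (Complex.exp (Complex.I * (α : ℂ)) * F z) * G τ x z := by
      filter_upwards [hIo.mem_nhds ht] with τ hτ
      exact rotatedKernel_eq_const_mul hτ x y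
    rw [hev.deriv_eq, ((h2 ht).const_mul _).deriv, hG.time_deriv_eq ht (hSΩ hzS) (h1 ht) (h2 ht)]
    ring
  rw [hKd]
  have hQ : 0 ≤ |y| + |x| := by positivity
  obtain ⟨e1, -, e3⟩ := le_exp_two_mul hQ
  refine norm_rotated_le (M := M₁ + M₂) hα0 hα1 ha₁ (ha1 t htcd) (ha2 t htcd) le_rfl
    (add_nonneg (mul_nonneg (abs_nonneg _) hM₀) (hG.A₁_nonneg t ht x)) ?_
    (by rw [← hzn]; exact hFb z (hSΩ hzS))
  have hE1 : ‖G' t x z‖ ≤ M₀ * Real.exp ((M₁ + M₂) * |y|) := by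
    refine (hG.growth t ht x z (hSΩ hzS)).trans ?_
    rw [hzn]
    gcongr
    · exact hA0 t htcd
    · linarith [hB0 t htcd]
  have hE2 : ‖deriv (fun τ => G' τ x z) t‖ ≤ A₁ t x * Real.exp ((M₁ + M₂) * |y|) := by
    refine (h3 ht).trans ?_
    rw [hzn]
    have := hG.A₁_nonneg t ht x
    gcongr
    linarith [hB1 t htcd]
  have hw : ‖z - (x : ℂ)‖ ≤ |y| + |x| := norm_ofReal_mul_exp_sub_le le_rfl
  calc ‖Complex.I * a' t * (z - x) ^ 2 * G' t x z + deriv (fun τ => G' τ x z) t‖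
      ≤ |a' t| * ‖z - x‖ ^ 2 * ‖G' t x z‖ + ‖deriv (fun τ => G' τ x z) t‖ := by
        refine (norm_add_le _ _).trans_eq ?_
        simp
    _ ≤ |a' t| * Real.exp (2 * (|y| + |x|)) * (M₀ * Real.exp ((M₁ + M₂) * |y|)) +
        A₁ t x * Real.exp ((M₁ + M₂) * |y|) * Real.exp (2 * (|y| + |x|)) := by
        refine add_le_add ?_ ?_
        · gcongr
          exact (pow_le_pow_left₀ (norm_nonneg _) hw 2).trans e3
        · exact hE2.trans (le_mul_of_one_le_right ((norm_nonneg _).trans hE2) e1)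
    _ = _ := by ring

/-- Domination of the first two space derivatives of the kernel, locally uniformly in space. -/
lemma GreenAssumption.exists_bound_space (hG : GreenAssumption T α Ω V G a G' A₀ B₀ A₁ B₁)
    (hα0 : 0 < α) (hα1 : α < Real.pi / 2) (hSΩ : doubleSector α ⊆ Ω)
    (hFb : ∀ z ∈ Ω, ‖F z‖ ≤ A * Real.exp (B * ‖z‖))
    (ht : t ∈ timeInterval T) (c d : ℝ) :
    ∃ b h : ℝ → ℝ, IntegrableOn b (Set.Icc c d) ∧ Integrable h ∧
      ∀ y, ∀ᵐ x : ℝ, x ∈ Set.Icc c d →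
        ‖deriv (fun ξ => rotatedKernel T α G F t ξ y) x‖ ≤ b x * h y ∧
        ‖deriv (deriv fun ξ => rotatedKernel T α G F t ξ y) x‖ ≤ b x * h y := by
  have ha := hG.a_pos t ht
  have hslice : ∀ {f : ℝ → ℝ → ℝ}, ContinuousOn (fun p : ℝ × ℝ => f p.1 p.2)
      (timeInterval T ×ˢ Set.univ) → ContinuousOn (f t) (Set.Icc c d) := fun hf =>
    hf.comp (f := fun x => (t, x)) (by fun_prop) fun x _ => ⟨ht, Set.mem_univ _⟩
  obtain ⟨M₀, hM₀, hA0⟩ := exists_nonneg_bound_on_Icc (hslice hG.A₀_cont)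
  obtain ⟨M₁, hM₁, hB0⟩ := exists_nonneg_bound_on_Icc (hslice hG.B₀_cont)
  obtain ⟨M₂, hM₂, hB1⟩ := exists_nonneg_bound_on_Icc (hslice hG.B₁_cont)
  have hsin : 0 < Real.sin (2 * α) := Real.sin_pos_of_pos_of_lt_pi (by linarith) (by linarith)
  set X := |c| + |d| with hX
  refine ⟨fun x => (2 * a t + 4 * a t ^ 2) * M₀ + (1 + 4 * a t) * A₁ t x,
    fun y => A * Real.exp (2 * X) *
    Real.exp (-(a t * Real.sin (2 * α)) * y ^ 2 + (B + 2 * a t * X + (M₁ + M₂) + 2) * |y|),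
    ?_, ?_, fun y => ?_⟩
  · refine Integrable.add (integrableOn_const (by simp)) ?_
    exact ((hG.A₁_space t ht).integrableOn_isCompact isCompact_Icc).const_mul _
  · exact (integrable_exp_neg_mul_sq_add_abs (mul_pos ha hsin) _).const_mul _
  set z : ℂ := (y : ℂ) * Complex.exp (Complex.I * (α : ℂ)) with hz
  have hzS : z ∈ doubleSector α := mul_exp_mem_doubleSector hα0 y
  have hzn : ‖z‖ = |y| := norm_ofReal_mul_exp α y
  filter_upwards [((hG.memAC12 z hzS).deriv_space t ht).ae_hasDerivAt isOpen_univ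
    Set.ordConnected_univ, hG.bound_dx t ht z hzS, hG.bound_dxx t ht z hzS] with x h1 h2 h3 hxcd
  have h1 := (h1 (Set.mem_univ x)).differentiableAt
  have hxX : |x| ≤ X := abs_le.2
    ⟨by linarith [hxcd.1, neg_abs_le c, abs_nonneg d],
      by linarith [hxcd.2, le_abs_self d, abs_nonneg c]⟩
  have hA1 := hG.A₁_nonneg t ht x
  have hQ : 0 ≤ |y| + X := by positivity
  obtain ⟨e1, e2, e3⟩ := le_exp_two_mul hQ
  have hβ : 0 ≤ (2 * a t + 4 * a t ^ 2) * M₀ + (1 + 4 * a t) * A₁ t x := by positivity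
  have hFz : ‖F z‖ ≤ A * Real.exp (B * |y|) := by rw [← hzn]; exact hFb z (hSΩ hzS)
  have hE0 : ‖G' t x z‖ ≤ M₀ * Real.exp ((M₁ + M₂) * |y|) := by
    refine (hG.growth t ht x z (hSΩ hzS)).trans ?_
    rw [hzn]
    gcongr
    · exact hA0 x hxcd
    · linarith [hB0 x hxcd]
  have hE1 : ‖deriv (fun ξ => G' t ξ z) x‖ ≤ A₁ t x * Real.exp ((M₁ + M₂) * |y|) := by
    refine h2.trans ?_
    rw [hzn]
    gcongr
    linarith [hB1 x hxcd]
  have hE2 : ‖deriv (deriv fun ξ => G' t ξ z) x‖ ≤ A₁ t x * Real.exp ((M₁ + M₂) * |y|) := by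
    refine h3.trans ?_
    rw [hzn]
    gcongr
    linarith [hB1 x hxcd]
  have hw : ‖z - (x : ℂ)‖ ≤ |y| + X := norm_ofReal_mul_exp_sub_le hxX
  have hw1 : ‖z - (x : ℂ)‖ ≤ Real.exp (2 * (|y| + X)) := hw.trans e2
  have hw2 : ‖z - (x : ℂ)‖ ^ 2 ≤ Real.exp (2 * (|y| + X)) :=
    (pow_le_pow_left₀ (norm_nonneg _) hw 2).trans e3
  set E := Real.exp ((M₁ + M₂) * |y|) with hE
  set W := Real.exp (2 * (|y| + X)) with hW
  have hEpos : 0 < E := Real.exp_pos _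
  have hWpos : 0 < W := Real.exp_pos _
  constructor
  · rw [hG.deriv_rotatedKernel_space hα0 ht]
    have hKd : Complex.exp (Complex.I * (α : ℂ)) * F z * deriv (fun ξ => G t ξ z) x =
        Complex.exp (Complex.I * (α : ℂ)) *
        (Complex.exp (Complex.I * (a t : ℂ) * (z - (x : ℂ)) ^ 2) *
          (-(2 * Complex.I * a t * (z - x)) * G' t x z + deriv (fun ξ => G' t ξ z) x) * F z) := by
      rw [hG.space_deriv_eq ht hzS (hSΩ hzS)]
      ring
    refine (congrArg norm hKd).trans_le ?_
    refine norm_rotated_le (M := M₁ + M₂) hα0 hα1 ha le_rfl le_rfl hxX hβ ?_ hFz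
    calc ‖-(2 * Complex.I * a t * (z - x)) * G' t x z + deriv (fun ξ => G' t ξ z) x‖
        ≤ 2 * a t * ‖z - x‖ * ‖G' t x z‖ + ‖deriv (fun ξ => G' t ξ z) x‖ := by
          refine (norm_add_le _ _).trans_eq ?_
          simp [abs_of_pos ha]
      _ ≤ 2 * a t * W * (M₀ * E) + A₁ t x * E * W := by
          refine add_le_add (by gcongr) ?_
          exact hE1.trans (le_mul_of_one_le_right (by positivity) e1)
      _ = (2 * a t * M₀ + A₁ t x) * E * W := by ring
      _ ≤ _ := by
          gcongr
          · nlinarith [mul_nonneg (sq_nonneg (a t)) hM₀]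
          · nlinarith
  · rw [hG.deriv_rotatedKernel_space hα0 ht]
    have hKd : deriv (fun x => Complex.exp (Complex.I * (α : ℂ)) * F z *
        deriv (fun ξ => G t ξ z) x) x = Complex.exp (Complex.I * (α : ℂ)) *
        (Complex.exp (Complex.I * (a t : ℂ) * (z - (x : ℂ)) ^ 2) *
        (deriv (deriv fun ξ => G' t ξ z) x -
          4 * Complex.I * a t * (z - x) * deriv (fun ξ => G' t ξ z) x +
          (2 * Complex.I * a t + (2 * Complex.I * a t * (z - x)) ^ 2) * G' t x z) * F z) := by
      rw [deriv_const_mul _ h1, hG.space_deriv_deriv_eq ht hzS (hSΩ hzS) h1]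
      ring
    refine (congrArg norm hKd).trans_le ?_
    refine norm_rotated_le (M := M₁ + M₂) hα0 hα1 ha le_rfl le_rfl hxX hβ ?_ hFz
    calc _ ≤ ‖deriv (deriv fun ξ => G' t ξ z) x‖ +
          4 * a t * ‖z - x‖ * ‖deriv (fun ξ => G' t ξ z) x‖ +
          (2 * a t + 4 * a t ^ 2 * ‖z - x‖ ^ 2) * ‖G' t x z‖ := by
          refine (norm_add_le _ _).trans (add_le_add ((norm_sub_le _ _).trans_eq ?_) ?_)
          · simp [abs_of_pos ha]
          · rw [norm_mul]
            refine mul_le_mul_of_nonneg_right ((norm_add_le _ _).trans_eq ?_) (norm_nonneg _)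
            norm_num [abs_of_pos ha, mul_pow]
      _ ≤ A₁ t x * E * W + 4 * a t * W * (A₁ t x * E) +
          (2 * a t * W + 4 * a t ^ 2 * W) * (M₀ * E) := by
          refine add_le_add (add_le_add ?_ (by gcongr)) ?_
          · exact hE2.trans (le_mul_of_one_le_right (by positivity) e1)
          · exact mul_le_mul (add_le_add (le_mul_of_one_le_right (by positivity) e1) (by gcongr))
              hE0 (norm_nonneg _) (by positivity)
      _ = _ := by ring

/-- The integral over the rotated line is a wave function. -/
theorem GreenAssumption.memAC12_and_solves (hG : GreenAssumption T α Ω V G a G' A₀ B₀ A₁ B₁)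
    (hα0 : 0 < α) (hα1 : α < Real.pi / 2) (hSΩ : doubleSector α ⊆ Ω)
    (hF : DifferentiableOn ℂ F Ω)
    (hFb : ∀ z ∈ Ω, ‖F z‖ ≤ A * Real.exp (B * ‖z‖))
    (hint : ∀ t ∈ timeInterval T, ∀ x, Integrable (rotatedKernel T α G F t x)) :
    MemAC12 T (fun t x => ∫ y, rotatedKernel T α G F t x y) ∧
      SolvesSchrodinger T V fun t x => ∫ y, rotatedKernel T α G F t x y := by
  refine memAC12_and_solves_integral (hG.measurable_rotatedKernel hα0 hSΩ hF)
    (fun t ht x y => rotatedKernel_of_notMem ht x y)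
    (fun t x => hG.continuous_rotatedKernel hα0 hSΩ hF t x)
    (fun x y => hG.isACOn_rotatedKernel_time hα0 x y)
    (fun t y => hG.differentiable_rotatedKernel hα0 t y)
    (fun t ht y => hG.isACOn_deriv_rotatedKernel hα0 ht y) hint
    (hG.exists_bound_time hα0 hα1 hSΩ hFb) (fun t ht c d _ => ?_) (fun t ht c d _ => ?_)
    (hG.solves_rotatedKernel hα0)
  · obtain ⟨b, h, hb, hh, hle⟩ := hG.exists_bound_space hα0 hα1 hSΩ hFb ht c d
    exact ⟨b, h, hb, hh, fun y => (hle y).mono fun x hx hm => (hx hm).1⟩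
  · obtain ⟨b, h, hb, hh, hle⟩ := hG.exists_bound_space hα0 hα1 hSΩ hFb ht c d
    exact ⟨b, h, hb, hh, fun y => (hle y).mono fun x hx hm => (hx hm).2⟩

end Derivatives

/-! ### The initial value and the conclusion -/

lemma ExtendsContinuously.exists_eventually_le {T : EReal} {f : ℝ → ℝ → ℝ}
    (hf : ExtendsContinuously T f) (hT : 0 < T) (x : ℝ) :
    ∃ C, 0 ≤ C ∧ ∀ᶠ t : ℝ in 𝓝[>] 0, f t x ≤ C := by
  obtain ⟨h, hc, heq⟩ := hf
  have h0 : ((0 : ℝ), x) ∈ timeIntervalZero T ×ˢ (Set.univ : Set ℝ) :=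
    ⟨⟨le_rfl, by simpa using hT⟩, Set.mem_univ _⟩
  have hev := eventually_mem_timeInterval hT
  have hlim : Tendsto (fun t : ℝ => h (t, x)) (𝓝[>] 0) (𝓝 (h (0, x))) := by
    refine (hc _ h0).tendsto.comp (tendsto_nhdsWithin_iff.2 ⟨?_, ?_⟩)
    · exact ((by fun_prop : Continuous fun t : ℝ => (t, x)).tendsto 0).mono_left nhdsWithin_le_nhds
    · filter_upwards [hev] with t ht using ⟨⟨ht.1.le, ht.2⟩, Set.mem_univ _⟩
  refine ⟨max (h (0, x) + 1) 0, le_max_right _ _, ?_⟩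
  filter_upwards [hev, hlim.eventually_lt_const (lt_add_one (h (0, x)))] with t ht hlt
  rw [← heq t ht x]
  exact hlt.le.trans (le_max_left _ _)

/-- A locally bounded family of holomorphic functions is equicontinuous, so that convergence at a
point persists along points converging to it. -/
lemma tendsto_apply_of_bounded_holomorphic {ι : Type*} {l : Filter ι} {f : ι → ℂ → ℂ} {c L : ℂ}
    {R C : ℝ} (hR : 0 < R) (hd : ∀ᶠ i in l, DifferentiableOn ℂ (f i) (Metric.ball c R))
    (hb : ∀ᶠ i in l, ∀ z ∈ Metric.ball c R, ‖f i z‖ ≤ C)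
    (hc : Tendsto (fun i => f i c) l (𝓝 L)) {z : ι → ℂ} (hz : Tendsto z l (𝓝 c)) :
    Tendsto (fun i => f i (z i)) l (𝓝 L) := by
  have hdist : Tendsto (fun i => (2 * C + 1) / R * dist (z i) c) l (𝓝 0) := by
    simpa using ((tendsto_iff_dist_tendsto_zero.1 hz).const_mul ((2 * C + 1) / R))
  have hdiff : Tendsto (fun i => f i (z i) - f i c) l (𝓝 0) := by
    refine squeeze_zero_norm' ?_ hdist
    filter_upwards [hd, hb, hz.eventually (Metric.ball_mem_nhds c hR)] with i hdi hbi hzi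
    rw [← dist_eq_norm]
    refine Complex.dist_le_div_mul_dist_of_mapsTo_ball hdi (fun w hw => ?_) hzi
    rw [Metric.mem_closedBall, dist_eq_norm]
    have h1 := hbi w hw
    have h2 := hbi c (Metric.mem_ball_self hR)
    linarith [norm_sub_le (f i w) (f i c)]
  simpa using hdiff.add hc

lemma Complex.cpow_half_sq (z : ℂ) : (z ^ (1 / 2 : ℂ)) ^ 2 = z := by
  rw [← Complex.cpow_nat_mul]
  norm_num

lemma Complex.cpow_half_re_im {z : ℂ} (hz : z ≠ 0) :
    (z ^ (1 / 2 : ℂ)).re = Real.exp (Real.log ‖z‖ / 2) * Real.cos (z.arg / 2) ∧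
    (z ^ (1 / 2 : ℂ)).im = Real.exp (Real.log ‖z‖ / 2) * Real.sin (z.arg / 2) := by
  rw [Complex.cpow_def_of_ne_zero hz]
  have h : Complex.log z * (1 / 2) = ((Real.log ‖z‖ / 2 : ℝ) : ℂ) + ((z.arg / 2 : ℝ) : ℂ) * I := by
    rw [Complex.log]
    push_cast
    ring
  rw [h, Complex.exp_re, Complex.exp_im]
  simp

/-- The Fresnel integral along a line of slope `k > 0`. The two branches of the square root are
told apart by the signs of the real parts. -/
lemma integral_fresnel_tilted {k : ℝ} (hk : 0 < k) :
    (1 + k * Complex.I) * ∫ u : ℝ, Complex.exp (Complex.I * ((u : ℂ) * (1 + k * Complex.I)) ^ 2) =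
      (Complex.I * (Real.pi : ℂ)) ^ (1 / 2 : ℂ) := by
  set m : ℂ := 1 + k * Complex.I with hm
  set b : ℂ := -Complex.I * m ^ 2 with hb
  have hm0 : m ≠ 0 := fun h => by simpa [hm] using congrArg Complex.re h
  have hbre : 0 < b.re := by simp [hb, hm, pow_two]; linarith
  have hb0 : b ≠ 0 := fun h => by simp [h] at hbre
  have hint : ∫ u : ℝ, Complex.exp (Complex.I * ((u : ℂ) * m) ^ 2) =
      ((Real.pi : ℂ) / b) ^ (1 / 2 : ℂ) := by
    rw [← integral_gaussian_complex hbre]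
    refine integral_congr_ae (Eventually.of_forall fun u => ?_)
    simp only [hb]
    congr 1
    ring
  rw [hint]
  set w := ((Real.pi : ℂ) / b) ^ (1 / 2 : ℂ) with hw
  set c := (Complex.I * (Real.pi : ℂ)) ^ (1 / 2 : ℂ) with hc
  have hpi : (Real.pi : ℂ) ≠ 0 := by exact_mod_cast Real.pi_ne_zero
  have hsq : (m * w) ^ 2 = c ^ 2 := by
    rw [mul_pow, hw, hc, Complex.cpow_half_sq, Complex.cpow_half_sq, hb]
    field_simp
    linear_combination -Complex.I_sq
  rcases sq_eq_sq_iff_eq_or_eq_neg.1 hsq with h | h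
  · exact h
  exfalso
  have hwre : 0 ≤ w.re := by
    rw [hw, (Complex.cpow_half_re_im (div_ne_zero hpi hb0)).1]
    refine mul_nonneg (Real.exp_pos _).le (Real.cos_nonneg_of_mem_Icc ⟨?_, ?_⟩)
    · linarith [Complex.neg_pi_lt_arg ((Real.pi : ℂ) / b)]
    · linarith [Complex.arg_le_pi ((Real.pi : ℂ) / b)]
  have harg : (Complex.I * (Real.pi : ℂ)).arg = Real.pi / 2 := by
    rw [Complex.arg_eq_pi_div_two_iff]
    simp [Real.pi_pos]
  obtain ⟨hcre, hcim⟩ := Complex.cpow_half_re_im (mul_ne_zero Complex.I_ne_zero hpi)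
  rw [← hc, harg] at hcre hcim
  have hpi4 : Real.pi / 2 / 2 = Real.pi / 4 := by ring
  have hcre0 : 0 < c.re := by
    rw [hcre, hpi4, Real.cos_pi_div_four]; positivity
  have hcim0 : 0 < c.im := by
    rw [hcim, hpi4, Real.sin_pi_div_four]; positivity
  have h1 := congrArg Complex.re h
  have h2 := congrArg Complex.im h
  simp [hm] at h1 h2
  nlinarith [mul_nonneg hwre (sq_nonneg k), mul_pos hk hcim0]

section InitialValue

variable {T : EReal} {α : ℝ} {Ω : Set ℂ} {V : ℝ → ℝ → ℂ} {G : ℝ → ℝ → ℂ → ℂ} {a : ℝ → ℝ}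
  {G' : ℝ → ℝ → ℂ → ℂ} {A₀ B₀ A₁ B₁ : ℝ → ℝ → ℝ} {F : ℂ → ℂ} {A B : ℝ} {t : ℝ}

lemma GreenAssumption.differentiableOn_remainder
    (hG : GreenAssumption T α Ω V G a G' A₀ B₀ A₁ B₁) (ht : t ∈ timeInterval T) (x : ℝ) :
    DifferentiableOn ℂ (G' t x) Ω :=
  ((by fun_prop : DifferentiableOn ℂ
    (fun z => Complex.exp (-(Complex.I * (a t : ℂ) * (z - (x : ℂ)) ^ 2))) Ω).mul
    (hG.holomorphic t ht x)).congr fun _ hz => hG.remainder_eq ht x hz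

/-- The parabolic rescaling `y = x + u / √a` of the integral over a tilted line through `x`. -/
lemma GreenAssumption.integral_tiltedLine_rescaled
    (hG : GreenAssumption T α Ω V G a G' A₀ B₀ A₁ B₁) (ht : t ∈ timeInterval T) (x : ℝ) {k : ℝ}
    (hline : ∀ y, tiltedLine x k y ∈ Ω) :
    ∫ y : ℝ, G t x (tiltedLine x k y) * F (tiltedLine x k y) =
      ∫ u : ℝ, Complex.exp (Complex.I * ((u : ℂ) * (1 + k * Complex.I)) ^ 2) *
        (G' t x (tiltedLine x k (x + (√(a t))⁻¹ * u)) / (√(a t) : ℂ)) *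
          F (tiltedLine x k (x + (√(a t))⁻¹ * u)) := by
  have ha := hG.a_pos t ht
  have hs : 0 < √(a t) := Real.sqrt_pos.2 ha
  have hs' : (√(a t) : ℂ) ≠ 0 := by exact_mod_cast hs.ne'
  rw [← integral_add_left_eq_self _ x]
  have h1 := Measure.integral_comp_mul_left
    (fun v : ℝ => G t x (tiltedLine x k (x + v)) * F (tiltedLine x k (x + v))) (√(a t))⁻¹
  rw [inv_inv, abs_of_pos hs, Complex.real_smul, ← inv_mul_eq_iff_eq_mul₀ hs'] at h1
  rw [← h1, ← integral_const_mul]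
  refine integral_congr_ae (Eventually.of_forall fun u => ?_)
  have hexp : Complex.I * (a t : ℂ) * (tiltedLine x k (x + (√(a t))⁻¹ * u) - (x : ℂ)) ^ 2 =
      Complex.I * ((u : ℂ) * (1 + k * Complex.I)) ^ 2 := by
    have h2 : (a t : ℂ) = (√(a t) : ℂ) ^ 2 := by exact_mod_cast (Real.sq_sqrt ha.le).symm
    rw [h2, tiltedLine]
    push_cast
    field_simp
    ring
  beta_reduce
  rw [hG.decomposition t ht x _ (hline _), hexp]
  ring

/-- Convergence to the initial value along a tilted line through `x`: after rescaling, the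
integrand converges to a Fresnel integrand under a fixed Gaussian majorant. -/
lemma GreenAssumption.tendsto_initial (hG : GreenAssumption T α Ω V G a G' A₀ B₀ A₁ B₁)
    (hT : 0 < T) (hΩ : IsOpen Ω) (hF : DifferentiableOn ℂ F Ω) (hA : 0 ≤ A) (hB : 0 ≤ B)
    (hFb : ∀ z ∈ Ω, ‖F z‖ ≤ A * Real.exp (B * ‖z‖)) (x : ℝ) {k : ℝ} (hk : 0 < k)
    (hline : ∀ y, tiltedLine x k y ∈ Ω) :
    Tendsto (fun t => (1 + k * Complex.I) *
      ∫ y : ℝ, G t x (tiltedLine x k y) * F (tiltedLine x k y)) (𝓝[>] 0) (𝓝 (F x)) := by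
  have hxΩ : (x : ℂ) ∈ Ω := by simpa [tiltedLine] using hline x
  have hev := eventually_mem_timeInterval hT
  obtain ⟨C₀, hC₀, hA0⟩ := hG.A₀_extends.exists_eventually_le hT x
  obtain ⟨M, hM, hB0⟩ := hG.B₀_extends.exists_eventually_le hT x
  set L : ℂ := 1 / (Complex.I * (Real.pi : ℂ)) ^ (1 / 2 : ℂ) with hL
  set ζ : ℝ → ℝ → ℂ := fun t u => tiltedLine x k (x + (√(a t))⁻¹ * u) with hζ
  have hgrow : ∀ᶠ t : ℝ in 𝓝[>] 0, ∀ z ∈ Ω,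
      ‖G' t x z / (√(a t) : ℂ)‖ ≤ C₀ * Real.exp (M * ‖z‖) := by
    filter_upwards [hev, hA0, hB0] with t ht h1 h2 z hz
    have hs : 0 < √(a t) := Real.sqrt_pos.2 (hG.a_pos t ht)
    rw [norm_div, Complex.norm_real, Real.norm_eq_abs, abs_of_pos hs]
    calc ‖G' t x z‖ / √(a t) ≤ A₀ t x * Real.exp (B₀ t x * ‖z‖) / √(a t) := by
          gcongr
          exact hG.growth t ht x z hz
      _ = A₀ t x / √(a t) * Real.exp (B₀ t x * ‖z‖) := by ring
      _ ≤ _ := by gcongr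
  have hinv : Tendsto (fun t => (√(a t))⁻¹) (𝓝[>] 0) (𝓝 0) :=
    tendsto_inv_atTop_zero.comp (Real.tendsto_sqrt_atTop.comp hG.a_tendsto)
  have hζlim : ∀ u, Tendsto (fun t => ζ t u) (𝓝[>] 0) (𝓝 (x : ℂ)) := by
    intro u
    have h1 : Tendsto (fun t => x + (√(a t))⁻¹ * u) (𝓝[>] 0) (𝓝 (x + 0 * u)) :=
      (hinv.mul_const u).const_add x
    rw [zero_mul, add_zero] at h1
    have h2 := ((continuous_tiltedLine x k).tendsto x).comp h1
    have h3 : tiltedLine x k x = x := by simp [tiltedLine]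
    rwa [h3] at h2
  have hpt : ∀ u, Tendsto (fun t => G' t x (ζ t u) / (√(a t) : ℂ)) (𝓝[>] 0) (𝓝 L) := by
    intro u
    obtain ⟨R, hR, hball⟩ := Metric.isOpen_iff.1 hΩ x hxΩ
    refine tendsto_apply_of_bounded_holomorphic (f := fun t z => G' t x z / (√(a t) : ℂ))
      (C := C₀ * Real.exp (M * (|x| + R))) hR ?_ ?_ (hG.limit x x hxΩ) (hζlim u)
    · filter_upwards [hev] with t ht
      exact ((hG.differentiableOn_remainder ht x).div_const _).mono hball
    · filter_upwards [hgrow] with t ht z hz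
      refine (ht z (hball hz)).trans ?_
      have : ‖z‖ ≤ |x| + R := by
        have h1 := norm_sub_norm_le z (x : ℂ)
        rw [Complex.norm_real, Real.norm_eq_abs] at h1
        have h2 := mem_ball_iff_norm.1 hz
        linarith
      gcongr
  have hFlim : ∀ u, Tendsto (fun t => F (ζ t u)) (𝓝[>] 0) (𝓝 (F x)) := fun u =>
    ((hF.continuousOn.continuousAt (hΩ.mem_nhds hxΩ)).tendsto).comp (hζlim u)
  have hζnorm : ∀ᶠ t : ℝ in 𝓝[>] 0, ∀ u, ‖ζ t u‖ ≤ |x| + (1 + k) * |u| := by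
    filter_upwards [hG.a_tendsto.eventually_ge_atTop 1] with t ht u
    have h1 : (√(a t))⁻¹ ≤ 1 := inv_le_one_of_one_le₀ (Real.one_le_sqrt.2 ht)
    have h2 : ζ t u = (x : ℂ) + (((√(a t))⁻¹ * u : ℝ) : ℂ) * (1 + k * Complex.I) := by
      simp only [hζ, tiltedLine]
      push_cast
      ring
    have h3 : ‖(1 : ℂ) + k * Complex.I‖ ≤ 1 + k := by
      refine (norm_add_le _ _).trans_eq ?_
      simp [abs_of_pos hk]
    rw [h2]
    refine (norm_add_le _ _).trans ?_
    rw [norm_mul, Complex.norm_real, Complex.norm_real, Real.norm_eq_abs, Real.norm_eq_abs,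
      abs_mul, abs_of_nonneg (inv_nonneg.2 (Real.sqrt_nonneg _))]
    have h4 : (√(a t))⁻¹ * |u| ≤ |u| := mul_le_of_le_one_left (abs_nonneg u) h1
    have h5 := mul_le_mul h4 h3 (norm_nonneg _) (abs_nonneg u)
    linarith
  have hphase : ∀ u : ℝ, ‖Complex.exp (Complex.I * ((u : ℂ) * (1 + k * Complex.I)) ^ 2)‖ =
      Real.exp (-(2 * k) * u ^ 2) := by
    intro u
    rw [Complex.norm_exp]
    congr 1
    simp [pow_two]
    ring
  have hlim : Tendsto (fun t => ∫ u : ℝ,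
      Complex.exp (Complex.I * ((u : ℂ) * (1 + k * Complex.I)) ^ 2) *
        (G' t x (ζ t u) / (√(a t) : ℂ)) * F (ζ t u)) (𝓝[>] 0)
      (𝓝 (∫ u : ℝ, Complex.exp (Complex.I * ((u : ℂ) * (1 + k * Complex.I)) ^ 2) * L * F x)) := by
    refine tendsto_integral_filter_of_dominated_convergence (fun u =>
      C₀ * A * Real.exp ((M + B) * |x|) *
        Real.exp (-(2 * k) * u ^ 2 + (M + B) * (1 + k) * |u|)) ?_ ?_ ?_ ?_
    · filter_upwards [hev] with t ht
      have hc : Continuous (ζ t) := (continuous_tiltedLine x k).comp (by fun_prop)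
      have hmem : ∀ u, ζ t u ∈ Ω := fun u => hline _
      refine Continuous.aestronglyMeasurable (((by fun_prop : Continuous fun u : ℝ =>
        Complex.exp (Complex.I * ((u : ℂ) * (1 + k * Complex.I)) ^ 2)).mul
        (Continuous.div_const ?_ _)).mul ?_)
      · exact (hG.differentiableOn_remainder ht x).continuousOn.comp_continuous hc hmem
      · exact hF.continuousOn.comp_continuous hc hmem
    · filter_upwards [hgrow, hζnorm] with t h1 h2
      refine Eventually.of_forall fun u => ?_
      have hmem : ζ t u ∈ Ω := hline _
      rw [norm_mul, norm_mul, hphase]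
      calc _ ≤ Real.exp (-(2 * k) * u ^ 2) * (C₀ * Real.exp (M * (|x| + (1 + k) * |u|))) *
            (A * Real.exp (B * (|x| + (1 + k) * |u|))) := by
            gcongr
            · exact (h1 _ hmem).trans (by gcongr; exact h2 u)
            · exact (hFb _ hmem).trans (by gcongr; exact h2 u)
        _ = C₀ * A * (Real.exp (-(2 * k) * u ^ 2) * (Real.exp (M * (|x| + (1 + k) * |u|)) *
            Real.exp (B * (|x| + (1 + k) * |u|)))) := by ring
        _ = _ := by
          rw [mul_assoc (C₀ * A), ← Real.exp_add, ← Real.exp_add, ← Real.exp_add]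
          ring_nf
    · exact (integrable_exp_neg_mul_sq_add_abs (by positivity) _).const_mul _
    · exact Eventually.of_forall fun u => ((hpt u).const_mul _).mul (hFlim u)
  have hval : (1 + k * Complex.I) * ∫ u : ℝ,
      Complex.exp (Complex.I * ((u : ℂ) * (1 + k * Complex.I)) ^ 2) * L * F x = F x := by
    have hne : (Complex.I * (Real.pi : ℂ)) ^ (1 / 2 : ℂ) ≠ 0 := by
      rw [Ne, Complex.cpow_eq_zero_iff]
      simp [Real.pi_ne_zero]
    rw [integral_mul_const, integral_mul_const, ← mul_assoc, ← mul_assoc,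
      integral_fresnel_tilted hk, hL, mul_one_div_cancel hne, one_mul]
  rw [← hval]
  refine (hlim.const_mul _).congr' ?_
  filter_upwards [hev] with t ht
  rw [hG.integral_tiltedLine_rescaled ht x hline]

end InitialValue

theorem mainTheorem1
    (T : EReal) (hT : 0 < T)
    (α : ℝ) (hα0 : 0 < α) (hα1 : α < Real.pi / 2)
    (Ω : Set ℂ) (hΩ : IsOpen Ω) (hSΩ : doubleSector α ⊆ Ω)
    (V : ℝ → ℝ → ℂ) (G : ℝ → ℝ → ℂ → ℂ)
    (a : ℝ → ℝ) (G' : ℝ → ℝ → ℂ → ℂ) (A₀ B₀ A₁ B₁ : ℝ → ℝ → ℝ)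
    (hG : GreenAssumption T α Ω V G a G' A₀ B₀ A₁ B₁)
    (F : ℂ → ℂ) (hF : DifferentiableOn ℂ F Ω)
    (A B : ℝ) (hA : 0 ≤ A) (hB : 0 ≤ B)
    (hFb : ∀ z ∈ Ω, ‖F z‖ ≤ A * Real.exp (B * ‖z‖)) :
    -- the regularised integrals converge absolutely
    (∀ t ∈ timeInterval T, ∀ x : ℝ, ∀ ε : ℝ, 0 < ε →
      Integrable (fun y : ℝ => (Real.exp (-ε * y ^ 2) : ℂ) * G t x (y : ℂ) * F (y : ℂ))) ∧
    ∃ Ψ : ℝ → ℝ → ℂ,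
      -- the limit defining the wave function exists
      (∀ t ∈ timeInterval T, ∀ x : ℝ,
        Tendsto (fun ε : ℝ =>
            ∫ y : ℝ, (Real.exp (-ε * y ^ 2) : ℂ) * G t x (y : ℂ) * F (y : ℂ))
          (𝓝[>] 0) (𝓝 (Ψ t x))) ∧
      -- the absolutely convergent representation on the rotated line
      (∀ t ∈ timeInterval T, ∀ x : ℝ,
        Integrable (fun y : ℝ =>
          G t x ((y : ℂ) * Complex.exp (Complex.I * (α : ℂ))) *
            F ((y : ℂ) * Complex.exp (Complex.I * (α : ℂ)))) ∧
        Ψ t x = Complex.exp (Complex.I * (α : ℂ)) *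
          ∫ y : ℝ, G t x ((y : ℂ) * Complex.exp (Complex.I * (α : ℂ))) *
            F ((y : ℂ) * Complex.exp (Complex.I * (α : ℂ)))) ∧
      -- regularity, the Schrödinger equation and the initial condition
      MemAC12 T Ψ ∧
      SolvesSchrodinger T V Ψ ∧
      (∀ x : ℝ, Tendsto (fun t => Ψ t x) (𝓝[>] 0) (𝓝 (F (x : ℂ)))) := by
  have htan : 0 < Real.tan α := Real.tan_pos_of_pos_of_lt_pi_div_two hα0 hα1
  have hsector : ∀ s ∈ Set.Icc 0 (Real.tan α), ∀ y, tiltedLine 0 s y ∈ Ω := fun s hs y =>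
    hSΩ (tiltedLine_mem_doubleSector hα0 hα1 hs y)
  have hcos : Real.cos α ≠ 0 := (Real.cos_pos_of_mem_Ioo ⟨by linarith [Real.pi_pos], hα1⟩).ne'
  have hint : ∀ t ∈ timeInterval T, ∀ x : ℝ, Integrable (fun y : ℝ =>
      G t x ((y : ℂ) * Complex.exp (Complex.I * (α : ℂ))) *
        F ((y : ℂ) * Complex.exp (Complex.I * (α : ℂ)))) := by
    intro t ht x
    have := (hG.integrable_tiltedLine hF hA hB hFb ht x htan
      (hsector _ ⟨htan.le, le_rfl⟩)).comp_mul_left' hcos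
    simpa only [tiltedLine_tan hα0 hα1] using this
  have hΨ : ∀ t ∈ timeInterval T, ∀ x : ℝ, ∫ y, rotatedKernel T α G F t x y =
      Complex.exp (Complex.I * (α : ℂ)) *
        ∫ y : ℝ, G t x ((y : ℂ) * Complex.exp (Complex.I * (α : ℂ))) *
          F ((y : ℂ) * Complex.exp (Complex.I * (α : ℂ))) := by
    intro t ht x
    simp only [rotatedKernel_of_mem ht]
    rw [integral_const_mul]
  have hlim : ∀ t ∈ timeInterval T, ∀ x : ℝ, Tendsto (fun ε : ℝ =>
      ∫ y : ℝ, (Real.exp (-ε * y ^ 2) : ℂ) * G t x (y : ℂ) * F (y : ℂ))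
      (𝓝[>] 0) (𝓝 (∫ y, rotatedKernel T α G F t x y)) := by
    intro t ht x
    rw [hΨ t ht x, ← integral_tiltedLine_tan hα0 hα1 fun z => G t x z * F z]
    exact hG.tendsto_regularized hΩ hF hA hB hFb ht x htan hsector
  obtain ⟨hmem, hsol⟩ := hG.memAC12_and_solves hα0 hα1 hSΩ hF hFb fun t ht x => by
    have h : rotatedKernel T α G F t x = _ := funext fun y => rotatedKernel_of_mem ht x y
    rw [h]
    exact (hint t ht x).const_mul _
  refine ⟨fun t ht x ε hε => hG.integrable_regularized hα0 hSΩ hF hA hB hFb ht x hε,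
    fun t x => ∫ y, rotatedKernel T α G F t x y, hlim, fun t ht x => ⟨hint t ht x, hΨ t ht x⟩,
    hmem, hsol, fun x => ?_⟩
  obtain ⟨k, hk, hline⟩ := exists_slope_tiltedLine_mem hα0 hα1 hΩ hSΩ x
  refine (hG.tendsto_initial hT hΩ hF hA hB hFb x hk (hline k ⟨hk.le, le_rfl⟩)).congr' ?_
  filter_upwards [eventually_mem_timeInterval hT] with t ht
  exact tendsto_nhds_unique (hG.tendsto_regularized hΩ hF hA hB hFb ht x hk hline) (hlim t ht x)
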